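/- Let $K$ be a field, $S=K[x_1,\dots,x_n]$, and let $I\subseteq S$ be a squarefree monomial ideal, i.e. an ideal generated by squarefree monomials. For an ideal $J\subseteq S$ let $J^{(s)}=\bigcap_{P\in\operatorname{Ass}(S/J)}(J^sS_P\cap S)$ be its $s$-th symbolic power and let $$\rho_a(J)=\sup\left\{\tfrac sr : s,r\ge 1,\ J^{(st)}\not\subseteq J^{rt}\ \text{for all } t\gg 0\right\}\in[0,\infty]$$ be its asymptotic resurgence (with $\sup\varnothing=0$). For a set $U$ of variables put $x_U=\prod_{x_i\in U}x_i$ and $I_U=(I:x_U^\infty)=\bigcup_k (I:x_U^k)$. Let $\mathrm{NP}(I)\subseteq\mathbb R^n$ be the Newton polyhedron of $I$, the convex hull of the exponent vectors of all monomials in $I$. A skew valuation is a linear functional $v:\mathbb R^n\to\mathbb R$ that is nonnegative on the first orthant; it is positive definite if $v(x_i):=v(e_i)>0$ for all $i$. Put $v(J)=\min\{v(\mathbf v):\mathbf x^{\mathbf v}\in J\}$ for a nonzero monomial ideal $J$, $\widehat v(I)=\lim_{s\to\infty}v(I^{(s)})/s$ and, if $v(I)>0$, $v_a(I)=v(I)/\widehat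 v(I)$. Let $V$ be the set of positive definite skew valuations $v$ such that for some $c>0$ the half-space $\{v\ge c\}$ is a defining half-space of $\mathrm{NP}(I)$, i.e. contains $\mathrm{NP}(I)$, and $\{v=c\}\cap \mathrm{NP}(I)$ is nonempty of dimension $n-1$. Then $\rho_a(I)$ is finite, $v_a(I)$ takes only finitely many values as $v$ runs over $V$, and $$\rho_a(I)=\max\Big\{\max_{U}\rho_a(I_U),\ \max_{v\in V}v_a(I)\Big\},$$ where $U$ runs over all subsets of the variables (and the second maximum is omitted if $V=\varnothing$). Moreover, if $n\ge 1$, the same formula holds with $U$ running only over the nonempty subsets of the variables. -/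

import Mathlib

open Filter Topology
open scoped ENNReal

noncomputable section

namespace SquarefreeResurgence

section CommutativeAlgebra

variable {R : Type*} [CommRing R]

/-- The `s`-th symbolic power `⋂_{P ∈ Ass(I)} (I ^ s R_P ∩ R)`, where `Ass(I)` is the set of
associated primes of `R ⧸ I`. -/
def symbolicPower (I : Ideal R) (s : ℕ) : Ideal R :=
  ⨅ P : Submodule.associatedPrimes I,
    ((I ^ s).map (algebraMap R (Localization.AtPrime P.1))).comap
      (algebraMap R (Localization.AtPrime P.1))

/-- The asymptotic resurgence
`sup {s / r : symbolicPower I (s t) is not contained in I ^ (r t) for all t ≫ 0}`,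
over positive integers `s, r`, as an element of `[0, ∞]`. -/
def asymptoticResurgence (I : Ideal R) : ℝ≥0∞ :=
  sSup {q : ℝ≥0∞ | ∃ s r : ℕ, 0 < s ∧ 0 < r ∧
    (∀ᶠ t : ℕ in atTop, ¬ symbolicPower I (s * t) ≤ I ^ (r * t)) ∧
    q = (s : ℝ≥0∞) / (r : ℝ≥0∞)}

/-- The saturation `(I : x ^ ∞) = ⋃_k (I : x ^ k)` (an increasing union). -/
def saturation (I : Ideal R) (x : R) : Ideal R :=
  ⨆ k : ℕ, Submodule.colon I {x ^ k}

theorem mem_saturation {I : Ideal R} {x f : R} :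
    f ∈ saturation I x ↔ ∃ k : ℕ, f * x ^ k ∈ I := by
  have hdir : Directed (· ≤ ·) fun k : ℕ => Submodule.colon I {x ^ k} := by
    refine Monotone.directed_le fun a b hab f hf => ?_
    rw [Submodule.mem_colon_singleton, smul_eq_mul] at hf ⊢
    obtain ⟨c, rfl⟩ := Nat.exists_eq_add_of_le hab
    rw [pow_add, ← mul_assoc]
    exact I.mul_mem_right _ hf
  unfold saturation
  rw [Submodule.mem_iSup_of_directed _ hdir]
  simp only [Submodule.mem_colon_singleton, smul_eq_mul]

theorem pow_le_symbolicPower (I : Ideal R) (s : ℕ) : I ^ s ≤ symbolicPower I s :=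
  le_iInf fun _ => Ideal.le_comap_map

theorem mul_mem_symbolicPower {I : Ideal R} {a b : ℕ} {f g : R}
    (hf : f ∈ symbolicPower I a) (hg : g ∈ symbolicPower I b) :
    f * g ∈ symbolicPower I (a + b) := by
  unfold symbolicPower at *
  rw [Submodule.mem_iInf] at *
  intro P
  have h1 := hf P
  have h2 := hg P
  rw [Ideal.mem_comap] at *
  rw [map_mul, pow_add, Ideal.map_mul]
  exact Ideal.mul_mem_mul h1 h2

end CommutativeAlgebra

section Monomial

variable {K : Type*} [Field K] {n : ℕ}

/-- An ideal generated by squarefree monomials, i.e. by products `∏ i ∈ a, x_i` over sets `a` of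
variables (the zero ideal and the unit ideal included). -/
def IsSquarefreeMonomialIdeal (I : Ideal (MvPolynomial (Fin n) K)) : Prop :=
  ∃ A : Set (Finset (Fin n)),
    I = Ideal.span ((fun a : Finset (Fin n) => ∏ i ∈ a, MvPolynomial.X i) '' A)

/-- The contraction `I_U = (I : x_U ^ ∞)`, with `x_U` the product of the variables in `U`. -/
def contraction (I : Ideal (MvPolynomial (Fin n) K)) (U : Finset (Fin n)) :
    Ideal (MvPolynomial (Fin n) K) :=
  saturation I (∏ i ∈ U, MvPolynomial.X i)

/-- The set of exponent vectors, in `ℝⁿ`, of the monomials that lie in `I`. -/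
def exponentVectors (I : Ideal (MvPolynomial (Fin n) K)) : Set (Fin n → ℝ) :=
  {w | ∃ m : Fin n →₀ ℕ, MvPolynomial.monomial m (1 : K) ∈ I ∧ w = fun i => (m i : ℝ)}

/-- The Newton polyhedron: the convex hull of the exponent vectors of all monomials of `I`. -/
def newtonPolyhedron (I : Ideal (MvPolynomial (Fin n) K)) : Set (Fin n → ℝ) :=
  convexHull ℝ (exponentVectors I)

/-- A skew valuation: a linear functional that is nonnegative on the first orthant. -/
def IsSkewValuation (v : (Fin n → ℝ) →ₗ[ℝ] ℝ) : Prop :=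
  ∀ w : Fin n → ℝ, (∀ i, 0 ≤ w i) → 0 ≤ v w

/-- A positive definite skew valuation: `v(x_i) > 0` for every variable `x_i`. -/
def IsPositiveDefinite (v : (Fin n → ℝ) →ₗ[ℝ] ℝ) : Prop :=
  IsSkewValuation v ∧ ∀ i, 0 < v (Pi.single i 1)

/-- The value `v(I)`: the minimum of `v` over the exponent vectors of the monomials of `I`. -/
def value (v : (Fin n → ℝ) →ₗ[ℝ] ℝ) (I : Ideal (MvPolynomial (Fin n) K)) : ℝ :=
  sInf (v '' exponentVectors I)

/-- The skew Waldschmidt constant: the limit of `v(I^(s)) / s`. The limit exists for every skew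
valuation and every ideal containing a monomial, see `tendsto_skewWaldschmidt`. -/
def skewWaldschmidt (v : (Fin n → ℝ) →ₗ[ℝ] ℝ) (I : Ideal (MvPolynomial (Fin n) K)) : ℝ :=
  limUnder atTop fun s : ℕ => value v (symbolicPower I s) / (s : ℝ)

/-- The skew resurgence of `I` with respect to `v` (a skew valuation with `v(I) > 0`): the ratio
of `v(I)` to the skew Waldschmidt constant. The division is in `[0, ∞]`. -/
def skewResurgence (v : (Fin n → ℝ) →ₗ[ℝ] ℝ) (I : Ideal (MvPolynomial (Fin n) K)) : ℝ≥0∞ :=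
  ENNReal.ofReal (value v I) / ENNReal.ofReal (skewWaldschmidt v I)

/-- The hyperplane `v = c`. -/
def hyperplane (v : (Fin n → ℝ) →ₗ[ℝ] ℝ) (c : ℝ) : Set (Fin n → ℝ) := {w | v w = c}

/-- The half-space `v ≥ c`. -/
def halfSpace (v : (Fin n → ℝ) →ₗ[ℝ] ℝ) (c : ℝ) : Set (Fin n → ℝ) := {w | c ≤ v w}

/-- The half-space `v ≥ c` is a supporting half-space of `C`. -/
def IsSupportingHalfSpace (C : Set (Fin n → ℝ)) (v : (Fin n → ℝ) →ₗ[ℝ] ℝ) (c : ℝ) : Prop :=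
  C ⊆ halfSpace v c ∧ (C ∩ hyperplane v c).Nonempty

/-- The half-space `v ≥ c` is a defining half-space of `C`: it supports `C`, and its boundary
hyperplane meets `C` in a set of codimension one (dimension `n - 1`). -/
def IsDefiningHalfSpace (C : Set (Fin n → ℝ)) (v : (Fin n → ℝ) →ₗ[ℝ] ℝ) (c : ℝ) : Prop :=
  IsSupportingHalfSpace C v c ∧
    Module.finrank ℝ (vectorSpan ℝ (C ∩ hyperplane v c)) + 1 = n

/-- The set `V` of positive definite skew valuations `v` for which some half-space `v ≥ c`, with
`c > 0`, is a defining half-space of the Newton polyhedron of `I`. -/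
def facetValuations (I : Ideal (MvPolynomial (Fin n) K)) : Set ((Fin n → ℝ) →ₗ[ℝ] ℝ) :=
  {v | IsPositiveDefinite v ∧ ∃ c : ℝ, 0 < c ∧ IsDefiningHalfSpace (newtonPolyhedron I) v c}

theorem exponentVectors_add {I : Ideal (MvPolynomial (Fin n) K)} {a b : ℕ} {w z : Fin n → ℝ}
    (hw : w ∈ exponentVectors (symbolicPower I a))
    (hz : z ∈ exponentVectors (symbolicPower I b)) :
    w + z ∈ exponentVectors (symbolicPower I (a + b)) := by
  obtain ⟨m, hm, rfl⟩ := hw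
  obtain ⟨k, hk, rfl⟩ := hz
  refine ⟨m + k, ?_, ?_⟩
  · have := mul_mem_symbolicPower hm hk
    rwa [MvPolynomial.monomial_mul, one_mul] at this
  · funext i
    simp

theorem exponentVectors_nonempty {I : Ideal (MvPolynomial (Fin n) K)}
    (h : (exponentVectors I).Nonempty) (s : ℕ) :
    (exponentVectors (symbolicPower I s)).Nonempty := by
  obtain ⟨_, m, hm, rfl⟩ := h
  refine ⟨_, s • m, ?_, rfl⟩
  have := pow_le_symbolicPower I s (Ideal.pow_mem_pow hm s)
  rwa [MvPolynomial.monomial_pow, one_pow] at this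

/-- The limit in the definition of the skew Waldschmidt constant exists. -/
theorem tendsto_skewWaldschmidt {v : (Fin n → ℝ) →ₗ[ℝ] ℝ} (hv : IsSkewValuation v)
    {I : Ideal (MvPolynomial (Fin n) K)} (h : (exponentVectors I).Nonempty) :
    Tendsto (fun s : ℕ => value v (symbolicPower I s) / (s : ℝ)) atTop
      (𝓝 (skewWaldschmidt v I)) := by
  have hnn : ∀ (J : Ideal (MvPolynomial (Fin n) K)), ∀ y ∈ v '' exponentVectors J, 0 ≤ y := by
    rintro J _ ⟨_, ⟨m, _, rfl⟩, rfl⟩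
    exact hv _ fun i => Nat.cast_nonneg _
  have hsub : Subadditive fun s : ℕ => value v (symbolicPower I s) := by
    intro a b
    have hadd : value v (symbolicPower I (a + b)) - value v (symbolicPower I b) ≤
        value v (symbolicPower I a) := by
      refine le_csInf ((exponentVectors_nonempty h a).image v) ?_
      rintro _ ⟨w, hw, rfl⟩
      have : value v (symbolicPower I (a + b)) - v w ≤ value v (symbolicPower I b) := by
        refine le_csInf ((exponentVectors_nonempty h b).image v) ?_
        rintro _ ⟨z, hz, rfl⟩
        have h3 : value v (symbolicPower I (a + b)) ≤ v (w + z) :=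
          csInf_le ⟨0, fun y hy => hnn _ y hy⟩ ⟨_, exponentVectors_add hw hz, rfl⟩
        rw [map_add] at h3
        linarith
      linarith
    show value v (symbolicPower I (a + b)) ≤ _
    linarith
  refine tendsto_nhds_limUnder ⟨_, hsub.tendsto_lim ⟨0, ?_⟩⟩
  rintro _ ⟨s, rfl⟩
  exact div_nonneg (Real.sInf_nonneg (hnn _)) (Nat.cast_nonneg _)

end Monomial

end SquarefreeResurgence

end

noncomputable section

namespace SquarefreeResurgence

variable {K : Type*} [Field K] {n : ℕ}

/-! Write `A` for the supports of the generators. Two polyhedra govern the problem. A monomial lies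
in the `s`-th symbolic power exactly when its degree along every vertex cover is at least `s`, so
symbolic powers are read off from `symbolicPolyhedron A`. By convex duality, up to an error bounded
independently of `r`, a monomial lies in the `r`-th ordinary power exactly when every `v` in
`blocker A` takes value at least `r` on it. Rounding errors disappear asymptotically, so the
asymptotic resurgence is the supremum of `1 / v w` over `v` in the blocker and `w` in the symbolic
polyhedron (`inv_le_asymptoticResurgence`, `exists_of_lt_asymptoticResurgence`).

For fixed `w`, slide `v` inside the blocker without increasing `v w` (`exists_blocker_vertex`).
Either `v` comes to vanish on a variable `x_i`, and the same pair `(v, w)` then bounds the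
resurgence of the contraction at `x_i`; or the generators with `v = 1` span the whole space, and `v`
is then a positive definite facet valuation with `1 / v w` at most its skew resurgence. Conversely,
contractions do not increase the resurgence (`asymptoticResurgence_sdiff_le`), and a facet
valuation, scaled to have minimum one on the Newton polyhedron, has Waldschmidt constant at least
the reciprocal of the resurgence. Finiteness of the set of values turns the supremum into a maximum.
-/

/-! ### Squarefree monomial ideals and their contractions -/

/-- The ideal generated by the squarefree monomials supported on the members of `A`. -/
def squarefreeIdeal (K : Type*) [Field K] {n : ℕ} (A : Set (Finset (Fin n))) :
    Ideal (MvPolynomial (Fin n) K) :=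
  Ideal.span ((fun a : Finset (Fin n) => ∏ i ∈ a, MvPolynomial.X i) '' A)

/-- The exponent vector of the squarefree monomial supported on `a`. -/
def squarefreeExponent (a : Finset (Fin n)) : Fin n →₀ ℕ := ∑ i ∈ a, Finsupp.single i 1

theorem squarefreeExponent_apply (a : Finset (Fin n)) (i : Fin n) :
    squarefreeExponent a i = if i ∈ a then 1 else 0 := by
  simp [squarefreeExponent, Finsupp.finsetSum_apply, Finsupp.single_apply]

theorem prod_X_eq_monomial (a : Finset (Fin n)) :
    (∏ i ∈ a, MvPolynomial.X i : MvPolynomial (Fin n) K) =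
      MvPolynomial.monomial (squarefreeExponent a) 1 := by
  rw [squarefreeExponent, MvPolynomial.monomial_sum_one]
  rfl

theorem squarefreeExponent_le {a : Finset (Fin n)} {m : Fin n →₀ ℕ} :
    squarefreeExponent a ≤ m ↔ ∀ i ∈ a, m i ≠ 0 := by
  refine forall_congr' fun i => ?_
  rw [squarefreeExponent_apply]
  split_ifs with h <;> simp [h, Nat.one_le_iff_ne_zero]

theorem mem_squarefreeIdeal {A : Set (Finset (Fin n))} {f : MvPolynomial (Fin n) K} :
    f ∈ squarefreeIdeal K A ↔ ∀ m ∈ f.support, ∃ a ∈ A, ∀ i ∈ a, m i ≠ 0 := by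
  have : squarefreeIdeal K A = Ideal.span
      ((fun s => MvPolynomial.monomial s (1 : K)) '' (squarefreeExponent '' A)) := by
    simp only [squarefreeIdeal, prod_X_eq_monomial, Set.image_image]
  rw [this, MvPolynomial.mem_ideal_span_monomial_image]
  simp [squarefreeExponent_le]

theorem monomial_mem_squarefreeIdeal {A : Set (Finset (Fin n))} {m : Fin n →₀ ℕ} :
    MvPolynomial.monomial m (1 : K) ∈ squarefreeIdeal K A ↔ ∃ a ∈ A, ∀ i ∈ a, m i ≠ 0 := by
  classical
  rw [mem_squarefreeIdeal, MvPolynomial.support_monomial, if_neg one_ne_zero]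
  simp

theorem mem_support_mul_monomial {f : MvPolynomial (Fin n) K} {m k : Fin n →₀ ℕ}
    (hm : m ∈ f.support) : m + k ∈ (f * MvPolynomial.monomial k 1).support := by
  rw [MvPolynomial.mem_support_iff, MvPolynomial.coeff_mul_monomial, mul_one]
  exact MvPolynomial.mem_support_iff.1 hm

theorem exists_of_mem_support_mul_monomial {f : MvPolynomial (Fin n) K} {m k : Fin n →₀ ℕ}
    (hm : m ∈ (f * MvPolynomial.monomial k 1).support) : ∃ m' ∈ f.support, m = m' + k := by
  classical
  rw [MvPolynomial.mem_support_iff, MvPolynomial.coeff_mul_monomial', mul_one] at hm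
  split_ifs at hm with h
  · exact ⟨m - k, MvPolynomial.mem_support_iff.2 hm, (tsub_add_cancel_of_le h).symm⟩
  · exact absurd rfl hm

theorem contraction_squarefreeIdeal (A : Set (Finset (Fin n))) (U : Finset (Fin n)) :
    contraction (squarefreeIdeal K A) U = squarefreeIdeal K ((fun a => a \ U) '' A) := by
  ext f
  rw [contraction, mem_saturation, prod_X_eq_monomial]
  simp only [MvPolynomial.monomial_pow, one_pow]
  constructor
  · rintro ⟨k, hk⟩
    rw [mem_squarefreeIdeal] at hk ⊢
    intro m hm
    obtain ⟨a, ha, h⟩ := hk _ (mem_support_mul_monomial hm)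
    refine ⟨_, ⟨a, ha, rfl⟩, fun i hi => ?_⟩
    rw [Finset.mem_sdiff] at hi
    have := h i hi.1
    simpa [squarefreeExponent_apply, hi.2] using this
  · intro hf
    -- One factor of `x_U` suffices because the generators are squarefree.
    refine ⟨1, ?_⟩
    rw [mem_squarefreeIdeal] at hf ⊢
    intro m hm
    obtain ⟨m', hm', rfl⟩ := exists_of_mem_support_mul_monomial hm
    obtain ⟨_, ⟨a, ha, rfl⟩, h⟩ := hf m' hm'
    refine ⟨a, ha, fun i hi => ?_⟩
    by_cases hU : i ∈ U
    · simp [squarefreeExponent_apply, hU]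
    · have := h i (by simp [hi, hU])
      simp [this]

/-! ### The blocker and the symbolic polyhedron -/

/-- The real vector of exponents of a monomial. -/
def realExponent (m : Fin n →₀ ℕ) : Fin n → ℝ := fun i => (m i : ℝ)

/-- The zero-one vector of a set of variables. -/
def indicatorVector (a : Finset (Fin n)) : Fin n → ℝ := fun i => if i ∈ a then 1 else 0

theorem realExponent_squarefreeExponent (a : Finset (Fin n)) :
    realExponent (squarefreeExponent a) = indicatorVector a := by
  ext i
  simp [realExponent, indicatorVector, squarefreeExponent_apply]

theorem realExponent_add (m k : Fin n →₀ ℕ) :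
    realExponent (m + k) = realExponent m + realExponent k := by
  ext i
  simp [realExponent]

theorem realExponent_nonneg (m : Fin n →₀ ℕ) (i : Fin n) : 0 ≤ realExponent m i :=
  Nat.cast_nonneg _

theorem IsSkewValuation.mono {v : (Fin n → ℝ) →ₗ[ℝ] ℝ} (hv : IsSkewValuation v)
    {w z : Fin n → ℝ} (h : ∀ i, w i ≤ z i) : v w ≤ v z := by
  have := hv (z - w) fun i => sub_nonneg.2 (h i)
  rw [map_sub] at this
  linarith

/-- The skew valuations that are at least one on the generators: the blocking polyhedron of the
Newton polyhedron. -/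
def blocker (A : Set (Finset (Fin n))) : Set ((Fin n → ℝ) →ₗ[ℝ] ℝ) :=
  {v | IsSkewValuation v ∧ ∀ a ∈ A, 1 ≤ v (indicatorVector a)}

/-- The vertex covers of a family of sets of variables. -/
def vertexCovers (A : Set (Finset (Fin n))) : Set (Finset (Fin n)) :=
  {c | ∀ a ∈ A, ∃ i ∈ a, i ∈ c}

/-- The symbolic polyhedron. -/
def symbolicPolyhedron (A : Set (Finset (Fin n))) : Set (Fin n → ℝ) :=
  {w | (∀ i, 0 ≤ w i) ∧ ∀ c ∈ vertexCovers A, 1 ≤ ∑ i ∈ c, w i}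

/-- Exponents add under multiplication, and each of the `r` factors from the ideal contributes at
least one to `v`. -/
theorem le_of_mem_pow {A : Set (Finset (Fin n))} {v : (Fin n → ℝ) →ₗ[ℝ] ℝ} (hv : v ∈ blocker A)
    (r : ℕ) {f : MvPolynomial (Fin n) K} (hf : f ∈ squarefreeIdeal K A ^ r) :
    ∀ m ∈ f.support, (r : ℝ) ≤ v (realExponent m) := by
  classical
  induction r generalizing f with
  | zero => intro m _; simpa using hv.1 _ (realExponent_nonneg m)
  | succ r ih =>
    rw [pow_succ] at hf
    refine Submodule.mul_induction_on hf ?_ ?_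
    · intro g hg h hh m hm
      obtain ⟨p, hp, q, hq, rfl⟩ := Finset.mem_add.1 (MvPolynomial.support_mul g h hm)
      obtain ⟨a, ha, hle⟩ := mem_squarefreeIdeal.1 hh q hq
      have h1 := ih hg p hp
      have h2 : v (indicatorVector a) ≤ v (realExponent q) := by
        refine hv.1.mono fun i => ?_
        rw [← realExponent_squarefreeExponent]
        exact Nat.cast_le.2 (squarefreeExponent_le.2 hle i)
      have h3 := hv.2 a ha
      rw [realExponent_add, map_add]
      push_cast
      linarith
    · intro g h hg hh m hm
      rcases Finset.mem_union.1 (MvPolynomial.support_add hm) with h1 | h1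
      · exact hg m h1
      · exact hh m h1

/-- The sum of the coordinates in `c`. -/
def coverValuation (c : Finset (Fin n)) : (Fin n → ℝ) →ₗ[ℝ] ℝ := ∑ i ∈ c, LinearMap.proj i

theorem coverValuation_apply (c : Finset (Fin n)) (w : Fin n → ℝ) :
    coverValuation c w = ∑ i ∈ c, w i := by
  simp [coverValuation]

theorem coverValuation_mem_blocker {A : Set (Finset (Fin n))} {c : Finset (Fin n)}
    (hc : c ∈ vertexCovers A) : coverValuation c ∈ blocker A := by
  refine ⟨fun w hw => ?_, fun a ha => ?_⟩
  · rw [coverValuation_apply]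
    exact Finset.sum_nonneg fun i _ => hw i
  · obtain ⟨i, hia, hic⟩ := hc a ha
    rw [coverValuation_apply]
    calc (1 : ℝ) = indicatorVector a i := by simp [indicatorVector, hia]
      _ ≤ _ := Finset.single_le_sum (f := indicatorVector a)
        (fun j _ => by unfold indicatorVector; split_ifs <;> norm_num) hic

/-! ### Symbolic powers and vertex covers -/

theorem weight_indicator (c : Finset (Fin n)) (m : Fin n →₀ ℕ) :
    Finsupp.weight (fun i => if i ∈ c then 1 else 0) m = ∑ i ∈ c, m i := by
  rw [Finsupp.weight_apply, Finsupp.sum_fintype _ _ (by simp)]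
  simp [Finset.sum_ite_mem]

/-- Passing to power series gives access to the additivity of the weighted order, which later yields
primality and the cancellation of denominators. -/
theorem le_weightedOrder_iff {c : Finset (Fin n)} {f : MvPolynomial (Fin n) K} {s : ℕ} :
    (s : ℕ∞) ≤ MvPowerSeries.weightedOrder (fun i => if i ∈ c then 1 else 0)
        (f : MvPowerSeries (Fin n) K) ↔ ∀ m ∈ f.support, s ≤ ∑ i ∈ c, m i := by
  constructor
  · intro h m hm
    by_contra! hlt
    have := MvPowerSeries.coeff_eq_zero_of_lt_weightedOrder
      (w := fun i => if i ∈ c then 1 else 0) (f := (f : MvPowerSeries (Fin n) K)) (d := m)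
      (lt_of_lt_of_le (by rw [weight_indicator]; exact_mod_cast hlt) h)
    rw [MvPolynomial.coeff_coe] at this
    exact MvPolynomial.mem_support_iff.1 hm this
  · intro h
    refine MvPowerSeries.le_weightedOrder _ fun m hm => ?_
    rw [MvPolynomial.coeff_coe]
    by_contra hne
    have := h m (MvPolynomial.mem_support_iff.2 hne)
    rw [weight_indicator] at hm
    exact absurd hm (not_lt.2 (by exact_mod_cast this))

/-- The variables in an associated prime are, up to units in the localization, in the ideal. -/
theorem exists_subset_of_isAssociatedPrime {A : Set (Finset (Fin n))}
    {P : Ideal (MvPolynomial (Fin n) K)} (hP : P ∈ Submodule.associatedPrimes (squarefreeIdeal K A))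
    {i : Fin n} (hi : MvPolynomial.X i ∈ P) :
    ∃ a ∈ A, ∀ j ∈ a, MvPolynomial.X j ∈ P → j = i := by
  classical
  obtain ⟨hprime, f, hf⟩ := Submodule.isAssociatedPrime_iff.1 hP
  have hX : ∀ j, MvPolynomial.X j ∈ P → f * MvPolynomial.monomial (Finsupp.single j 1) 1 ∈
      squarefreeIdeal K A := by
    intro j hj
    rw [hf, Submodule.mem_colon_singleton, smul_eq_mul, mul_comm] at hj
    exact hj
  have hfI : f ∉ squarefreeIdeal K A := by
    intro h
    refine hprime.ne_top ((Ideal.eq_top_iff_one _).2 ?_)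
    rw [hf, Submodule.mem_colon_singleton, one_smul]
    exact h
  rw [mem_squarefreeIdeal] at hfI
  push Not at hfI
  obtain ⟨m, hm, hmA⟩ := hfI
  obtain ⟨a, ha, hle⟩ := mem_squarefreeIdeal.1 (hX i hi) _ (mem_support_mul_monomial hm)
  refine ⟨a, ha, fun j hj hjP => ?_⟩
  by_contra hne
  -- Here `m` is a monomial of `f` outside the ideal, while `x_i m` is divisible by the generator of
  -- `a`. So `j ∈ a` with `j ≠ i` gives `m j ≠ 0`, whereas `x_j m` in the ideal and `m` outside it
  -- force `m j = 0`.
  have hmj : m j ≠ 0 := by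
    have := hle j hj
    rwa [Finsupp.add_apply, Finsupp.single_apply, if_neg (Ne.symm hne), add_zero] at this
  obtain ⟨b, hb, hle'⟩ := mem_squarefreeIdeal.1 (hX j hjP) _ (mem_support_mul_monomial hm)
  obtain ⟨k, hk, hk0⟩ := hmA b hb
  have := hle' k hk
  rw [Finsupp.add_apply, hk0, zero_add, Finsupp.single_apply] at this
  split_ifs at this with h
  · exact hmj (h ▸ hk0)
  · exact this rfl

/-- The variables in an associated prime `P` form a vertex cover `c`. Each of them lies in the
extension of the ideal to the localization at `P`, since some generator involves no other variable
of `P`. Hence a monomial of degree at least `s` along `c` lies in the extended `s`-th power. -/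
theorem mem_symbolicPower_of_forall {A : Set (Finset (Fin n))} {s : ℕ}
    {f : MvPolynomial (Fin n) K}
    (h : ∀ c ∈ vertexCovers A, ∀ m ∈ f.support, s ≤ ∑ i ∈ c, m i) :
    f ∈ symbolicPower (squarefreeIdeal K A) s := by
  classical
  rw [symbolicPower, Submodule.mem_iInf]
  rintro ⟨P, hP⟩
  have hprime : P.IsPrime := hP.1
  have hIP : squarefreeIdeal K A ≤ P := by
    obtain ⟨_, g, rfl⟩ := Submodule.isAssociatedPrime_iff.1 hP
    intro p hp
    rw [Submodule.mem_colon_singleton, smul_eq_mul]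
    exact Ideal.mul_mem_right _ _ hp
  rw [Ideal.mem_comap]
  set c : Finset (Fin n) := Finset.univ.filter fun i => (MvPolynomial.X i : MvPolynomial _ K) ∈ P
  have hc : c ∈ vertexCovers A := by
    intro a ha
    have : ∏ i ∈ a, (MvPolynomial.X i : MvPolynomial (Fin n) K) ∈ P :=
      hIP (Ideal.subset_span ⟨a, ha, rfl⟩)
    obtain ⟨i, hi, hiP⟩ := hprime.prod_mem_iff.1 this
    exact ⟨i, hi, by simp [c, hiP]⟩
  have hvar : ∀ i ∈ c, algebraMap (MvPolynomial (Fin n) K) (Localization.AtPrime P)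
      (MvPolynomial.X i) ∈
      (squarefreeIdeal K A).map (algebraMap _ (Localization.AtPrime P)) := by
    intro i hi
    have hiP : (MvPolynomial.X i : MvPolynomial (Fin n) K) ∈ P := by simpa [c] using hi
    obtain ⟨a, ha, hai⟩ := exists_subset_of_isAssociatedPrime hP hiP
    have hunit : IsUnit (algebraMap _ (Localization.AtPrime P)
        (∏ j ∈ a.erase i, (MvPolynomial.X j : MvPolynomial (Fin n) K))) := by
      refine IsLocalization.map_units (M := P.primeCompl) _ ⟨_, ?_⟩
      change _ ∉ P
      intro hmem
      obtain ⟨j, hj, hjP⟩ := hprime.prod_mem_iff.1 hmem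
      exact (Finset.mem_erase.1 hj).1 (hai j (Finset.mem_of_mem_erase hj) hjP)
    have hmem : (∏ j ∈ a.erase i, (MvPolynomial.X j : MvPolynomial (Fin n) K)) *
        MvPolynomial.X i ∈ squarefreeIdeal K A := by
      rw [mul_comm]
      by_cases hia : i ∈ a
      · rw [Finset.mul_prod_erase _ _ hia]
        exact Ideal.subset_span ⟨a, ha, rfl⟩
      · rw [Finset.erase_eq_of_notMem hia]
        exact Ideal.mul_mem_left _ _ (Ideal.subset_span ⟨a, ha, rfl⟩)
    have := Ideal.mem_map_of_mem (algebraMap _ (Localization.AtPrime P)) hmem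
    rw [map_mul] at this
    exact (Ideal.unit_mul_mem_iff_mem _ hunit).1 this
  rw [f.as_sum, map_sum]
  refine Ideal.sum_mem _ fun m hm => ?_
  rw [MvPolynomial.monomial_eq, map_mul, Finsupp.prod_fintype _ _ (by simp), map_prod,
    ← Finset.prod_mul_prod_compl c, Ideal.map_pow]
  refine Ideal.mul_mem_left _ _ (Ideal.mul_mem_right _ _ ?_)
  refine Ideal.pow_le_pow_right (h c hc m hm) ?_
  rw [← Finset.prod_pow_eq_pow_sum]
  refine Ideal.prod_mem_prod fun i hi => ?_
  rw [map_pow]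
  exact Ideal.pow_mem_pow (hvar i hi) _

/-- The colon ideal is the monomial prime generated by the variables of `c`. -/
theorem mem_colon_compl_iff {A : Set (Finset (Fin n))} {c : Finset (Fin n)}
    (hc : Minimal (· ∈ vertexCovers A) c) {g : MvPolynomial (Fin n) K} :
    g ∈ Submodule.colon (squarefreeIdeal K A)
        {MvPolynomial.monomial (squarefreeExponent cᶜ) 1} ↔
      ∀ m ∈ g.support, 1 ≤ ∑ i ∈ c, m i := by
  have hsum : ∀ m : Fin n →₀ ℕ, 1 ≤ ∑ i ∈ c, m i ↔ ∃ i ∈ c, m i ≠ 0 := by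
    intro m
    rw [Nat.one_le_iff_ne_zero, Ne, Finset.sum_eq_zero_iff]
    push Not
    rfl
  rw [Submodule.mem_colon_singleton, smul_eq_mul, mem_squarefreeIdeal]
  simp only [hsum]
  constructor
  · intro h m hm
    obtain ⟨a, ha, hle⟩ := h _ (mem_support_mul_monomial hm)
    obtain ⟨i, hia, hic⟩ := hc.prop a ha
    refine ⟨i, hic, ?_⟩
    simpa [squarefreeExponent_apply, hic] using hle i hia
  · intro h m hm
    obtain ⟨m, hm', rfl⟩ := exists_of_mem_support_mul_monomial hm
    obtain ⟨i, hic, hmi⟩ := h m hm'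
    -- By minimality some generator meets `c` in `i` alone; its other variables are supplied by the
    -- complement of `c`.
    have hnot : c.erase i ∉ vertexCovers A := fun hmem =>
      absurd (hc.le_of_le hmem (Finset.erase_subset i c) hic) (Finset.notMem_erase i c)
    simp only [vertexCovers, Set.mem_ofPred_eq] at hnot
    push Not at hnot
    obtain ⟨a, ha, hdisj⟩ := hnot
    refine ⟨a, ha, fun j hj => ?_⟩
    have := hdisj j hj
    rw [Finset.mem_erase] at this
    rw [Finsupp.add_apply, squarefreeExponent_apply]
    by_cases hjc : j ∈ c
    · by_cases hji : j = i
      · subst hji; simp [hmi]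
      · exact absurd hjc (by tauto)
    · simp [hjc]

theorem mem_colon_compl_iff_weightedOrder {A : Set (Finset (Fin n))} {c : Finset (Fin n)}
    (hc : Minimal (· ∈ vertexCovers A) c) {g : MvPolynomial (Fin n) K} :
    g ∈ Submodule.colon (squarefreeIdeal K A)
        {MvPolynomial.monomial (squarefreeExponent cᶜ) 1} ↔
      MvPowerSeries.weightedOrder (fun i => if i ∈ c then 1 else 0)
        (g : MvPowerSeries (Fin n) K) ≠ 0 := by
  rw [mem_colon_compl_iff hc, ← le_weightedOrder_iff, Nat.cast_one, Order.one_le_iff_ne_zero]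

theorem isAssociatedPrime_of_minimal {A : Set (Finset (Fin n))} {c : Finset (Fin n)}
    (hc : Minimal (· ∈ vertexCovers A) c) :
    Submodule.colon (squarefreeIdeal K A)
        {(MvPolynomial.monomial (squarefreeExponent cᶜ) 1 : MvPolynomial (Fin n) K)} ∈
      Submodule.associatedPrimes (squarefreeIdeal K A) := by
  refine Submodule.isAssociatedPrime_iff.2 ⟨⟨?_, ?_⟩, _, rfl⟩
  · rw [Ne, Ideal.eq_top_iff_one, mem_colon_compl_iff hc]
    intro h
    have := h 0 (by simp)
    simp at this
  · intro x y
    simp only [mem_colon_compl_iff_weightedOrder hc, MvPolynomial.coe_mul,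
      MvPowerSeries.weightedOrder_mul]
    intro h
    by_contra! h'
    exact h (by rw [h'.1, h'.2, add_zero])

/-- It suffices to treat a minimal cover `d`. Clearing denominators puts a multiple `u f` with `u ∉
P` in the `s`-th power; `u` has order zero along `d`, so by additivity `f` itself has order at least
`s`. -/
theorem le_of_mem_symbolicPower {A : Set (Finset (Fin n))} {s : ℕ}
    {f : MvPolynomial (Fin n) K} (hf : f ∈ symbolicPower (squarefreeIdeal K A) s)
    {c : Finset (Fin n)} (hc : c ∈ vertexCovers A) {m : Fin n →₀ ℕ} (hm : m ∈ f.support) :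
    s ≤ ∑ i ∈ c, m i := by
  obtain ⟨d, hdc, hd⟩ := exists_minimal_le_of_wellFoundedLT (· ∈ vertexCovers A) c hc
  refine le_trans ?_ (Finset.sum_le_sum_of_subset hdc)
  revert m
  have hP := isAssociatedPrime_of_minimal (K := K) hd
  set P := Submodule.colon (squarefreeIdeal K A)
        {(MvPolynomial.monomial (squarefreeExponent dᶜ) 1 : MvPolynomial (Fin n) K)}
  have hprime : P.IsPrime := hP.1
  rw [symbolicPower, Submodule.mem_iInf] at hf
  have hfP := hf ⟨P, hP⟩
  rw [Ideal.mem_comap] at hfP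
  obtain ⟨⟨⟨g, hg⟩, u⟩, hgu⟩ := (IsLocalization.mem_map_algebraMap_iff P.primeCompl _).1 hfP
  simp only at hgu
  rw [← map_mul] at hgu
  obtain ⟨u', hu'⟩ := (IsLocalization.eq_iff_exists P.primeCompl _).1 hgu
  have hmem : (u' * u : MvPolynomial (Fin n) K) * f ∈ squarefreeIdeal K A ^ s := by
    have : (u' * u : MvPolynomial (Fin n) K) * f = u' * g := by rw [← hu']; ring
    rw [this]
    exact Ideal.mul_mem_left _ _ hg
  have hu0 : (u' * u : MvPolynomial (Fin n) K) ∉ P := (u' * u).2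
  replace hu0 := not_not.1 fun h => hu0 ((mem_colon_compl_iff_weightedOrder hd).2 h)
  have hw : ∀ m ∈ ((u' * u : MvPolynomial (Fin n) K) * f).support, s ≤ ∑ i ∈ d, m i := by
    intro m hm
    have := le_of_mem_pow (coverValuation_mem_blocker hd.prop) s hmem m hm
    rw [coverValuation_apply] at this
    simp only [realExponent] at this
    exact_mod_cast this
  rw [← le_weightedOrder_iff, MvPolynomial.coe_mul, MvPowerSeries.weightedOrder_mul, hu0,
    zero_add] at hw
  exact fun {m} => le_weightedOrder_iff.1 hw m

/-! ### Polyhedral duality and vertices of the blocker -/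

theorem apply_eq_sum_single (v : (Fin n → ℝ) →ₗ[ℝ] ℝ) (w : Fin n → ℝ) :
    v w = ∑ i, w i * v (Pi.single i 1) := by
  rw [LinearMap.pi_apply_eq_sum_univ]
  refine Finset.sum_congr rfl fun i _ => ?_
  rw [smul_eq_mul]
  congr 2
  ext j
  simp [Pi.single_apply, eq_comm]

theorem isSkewValuation_iff {v : (Fin n → ℝ) →ₗ[ℝ] ℝ} :
    IsSkewValuation v ↔ ∀ i, 0 ≤ v (Pi.single i 1) := by
  constructor
  · intro h i
    refine h _ fun j => ?_
    rw [Pi.single_apply]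
    split_ifs <;> norm_num
  · intro h w hw
    rw [apply_eq_sum_single]
    exact Finset.sum_nonneg fun i _ => mul_nonneg (hw i) (h i)

theorem indicatorVector_injective : Function.Injective (indicatorVector (n := n)) := by
  intro a b h
  ext i
  have := congrFun h i
  by_cases ha : i ∈ a <;> by_cases hb : i ∈ b <;> simp_all [indicatorVector]

open scoped Pointwise in
/-- Blocking duality for the Newton polyhedron. -/
theorem exists_fractional_packing {A : Set (Finset (Fin n))} {w : Fin n → ℝ}
    (hw : ∀ i, 0 ≤ w i) {R : ℝ} (hR : 0 < R) (h : ∀ v ∈ blocker A, R ≤ v w) :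
    ∃ l : Finset (Fin n) → ℝ, (∀ a, 0 ≤ l a) ∧ (∀ a, a ∉ A → l a = 0) ∧ ∑ a, l a = R ∧
      ∀ i, ∑ a, l a * indicatorVector a i ≤ w i := by
  classical
  have hA : A.Nonempty := by
    by_contra hA
    rw [Set.not_nonempty_iff_eq_empty] at hA
    have := h 0 ⟨fun _ _ => le_rfl, by simp [hA]⟩
    simp at this
    linarith
  obtain ⟨a₀, ha₀⟩ := hA
  set G : Set (Fin n → ℝ) := indicatorVector '' A
  have hGfin : G.Finite := (Set.toFinite A).image _
  set B : Set (Fin n → ℝ) := convexHull ℝ G + {y : Fin n → ℝ | ∀ i, 0 ≤ y i}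
  have horth : Convex ℝ {y : Fin n → ℝ | ∀ i, 0 ≤ y i} := by
    intro x hx y hy s t hs ht _ i
    exact add_nonneg (mul_nonneg hs (hx i)) (mul_nonneg ht (hy i))
  have horthc : IsClosed {y : Fin n → ℝ | ∀ i, 0 ≤ y i} := by
    have : {y : Fin n → ℝ | ∀ i, 0 ≤ y i} = ⋂ i, {y | 0 ≤ y i} := by ext; simp
    rw [this]
    exact isClosed_iInter fun i => isClosed_le continuous_const (continuous_apply i)
  have hBconv : Convex ℝ B := (convex_convexHull ℝ G).add horth
  have hBclosed : IsClosed B := horthc.add_left_of_isCompact (hGfin.isCompact_convexHull ℝ)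
  -- A functional separating `R⁻¹ • w` from the closed convex set `B` is bounded below on a
  -- translate of the orthant, hence a skew valuation; divided by `u` it lies in the blocker and has
  -- value less than `R` at `w`.
  have hmem : R⁻¹ • w ∈ B := by
    by_contra hnot
    obtain ⟨f, u, hfu, hf⟩ := geometric_hahn_banach_point_closed hBconv hBclosed hnot
    have hGB : ∀ a ∈ A, ∀ y : Fin n → ℝ, (∀ i, 0 ≤ y i) → u < f (indicatorVector a) + f y := by
      intro a ha y hy
      rw [← map_add]
      exact hf _ (Set.add_mem_add (subset_convexHull ℝ _ ⟨a, ha, rfl⟩) hy)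
    have hskew : IsSkewValuation (f : (Fin n → ℝ) →ₗ[ℝ] ℝ) := by
      intro y hy
      by_contra! hneg
      change f y < 0 at hneg
      obtain ⟨k, hk⟩ := exists_nat_gt ((f (indicatorVector a₀) - u) / (-f y))
      rw [div_lt_iff₀ (by linarith)] at hk
      have := hGB a₀ ha₀ ((k : ℝ) • y) fun i => mul_nonneg (Nat.cast_nonneg _) (hy i)
      rw [map_smul, smul_eq_mul] at this
      linarith
    have hu : 0 < u := by
      have : 0 ≤ f (R⁻¹ • w) := hskew _ fun i => mul_nonneg (inv_nonneg.2 hR.le) (hw i)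
      linarith
    have hv := h (u⁻¹ • (f : (Fin n → ℝ) →ₗ[ℝ] ℝ)) ⟨fun y hy => ?_, fun a ha => ?_⟩
    · change R ≤ u⁻¹ * f w at hv
      rw [map_smul, smul_eq_mul, inv_mul_lt_iff₀ hR] at hfu
      rw [le_inv_mul_iff₀ hu] at hv
      linarith
    · exact mul_nonneg (inv_nonneg.2 hu.le) (hskew y hy)
    · change 1 ≤ u⁻¹ * f (indicatorVector a)
      have := hGB a ha 0 fun i => le_rfl
      rw [map_zero, add_zero] at this
      rw [le_inv_mul_iff₀ hu]
      linarith
  obtain ⟨x, hx, y, hy, hxy⟩ := hmem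
  have hGf : G = ((A.toFinset.image indicatorVector : Finset (Fin n → ℝ)) : Set (Fin n → ℝ)) := by
    simp [G]
  rw [hGf, Finset.mem_convexHull'] at hx
  obtain ⟨c, hc0, hc1, hcx⟩ := hx
  rw [Finset.sum_image indicatorVector_injective.injOn] at hc1 hcx
  refine ⟨fun a => if a ∈ A.toFinset then R * c (indicatorVector a) else 0, fun a => ?_,
    fun a ha => ?_, ?_, fun i => ?_⟩
  · beta_reduce
    split_ifs with ha
    · exact mul_nonneg hR.le (hc0 _ (Finset.mem_image_of_mem _ ha))
    · exact le_rfl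
  · simp [ha]
  · rw [Finset.sum_ite_mem, Finset.univ_inter, ← Finset.mul_sum, hc1, mul_one]
  · simp only [ite_mul, zero_mul]
    rw [Finset.sum_ite_mem, Finset.univ_inter]
    have h1 := congrFun hxy i
    have h2 := congrFun hcx i
    simp only [Finset.sum_apply, Pi.smul_apply, Pi.add_apply, smul_eq_mul] at h1 h2
    simp only [mul_assoc]
    rw [← Finset.mul_sum, h2]
    have h3 := hy i
    have : x i ≤ R⁻¹ * w i := by linarith
    rwa [le_inv_mul_iff₀ hR] at this

/-- Moving along a ray until one of finitely many inequalities becomes an equality. -/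
theorem exists_first_tight {ι : Type*} (s : Finset ι) (α β : ι → ℝ) (hα : ∀ j ∈ s, 0 ≤ α j)
    (hβ : ∃ j ∈ s, β j < 0) :
    ∃ t : ℝ, 0 ≤ t ∧ (∀ j ∈ s, 0 ≤ α j + t * β j) ∧ ∃ j ∈ s, β j < 0 ∧ α j + t * β j = 0 := by
  classical
  obtain ⟨j₀, hj₀, hlt⟩ := hβ
  obtain ⟨j, hj, hmin⟩ := Finset.exists_min_image (s.filter fun j => β j < 0)
    (fun j => α j / (-β j)) ⟨j₀, by simp [hj₀, hlt]⟩
  rw [Finset.mem_filter] at hj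
  refine ⟨α j / (-β j), div_nonneg (hα j hj.1) (by linarith), fun k hk => ?_, j, hj.1, hj.2, ?_⟩
  · rcases lt_or_ge (β k) 0 with hkn | hkn
    · have := hmin k (by simp [hk, hkn])
      rw [le_div_iff₀ (by linarith)] at this
      linarith
    · exact add_nonneg (hα k hk)
        (mul_nonneg (div_nonneg (hα j hj.1) (by linarith)) hkn)
  · have : β j ≠ 0 := hj.2.ne
    field_simp
    ring

/-- The span of the generators on which `v` is one. -/
def tightSpan (A : Set (Finset (Fin n))) (v : (Fin n → ℝ) →ₗ[ℝ] ℝ) : Submodule ℝ (Fin n → ℝ) :=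
  Submodule.span ℝ (indicatorVector '' {a | a ∈ A ∧ v (indicatorVector a) = 1})

/-- Move from `v` along a functional `u` that kills all tight generators and does not increase the
value at `w`, until a new inequality becomes tight: either a coordinate vanishes or a generator
outside the old span becomes tight. -/
theorem exists_blocker_tighter {A : Set (Finset (Fin n))} {w : Fin n → ℝ} (hw : ∀ i, 0 ≤ w i)
    {v : (Fin n → ℝ) →ₗ[ℝ] ℝ} (hv : v ∈ blocker A) (htop : tightSpan A v ≠ ⊤) :
    ∃ v' ∈ blocker A, v' w ≤ v w ∧
      ((∃ i, v' (Pi.single i 1) = 0) ∨ tightSpan A v < tightSpan A v') := by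
  classical
  -- One of `u` and `-u` always works; the negative coordinate guarantees that the ray leaves the
  -- blocker.
  obtain ⟨u, hu, hle, huw, hneg⟩ : ∃ u : (Fin n → ℝ) →ₗ[ℝ] ℝ, u ≠ 0 ∧
      tightSpan A v ≤ LinearMap.ker u ∧ u w ≤ 0 ∧ ∃ i, u (Pi.single i 1) < 0 := by
    obtain ⟨u, hu, hle⟩ := Submodule.exists_le_ker_of_lt_top _ (lt_top_iff_ne_top.2 htop)
    have hnegker : tightSpan A v ≤ LinearMap.ker (-u) := fun x hx => by
      have : u x = 0 := hle hx
      simp [this]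
    by_cases hpos : ∃ i, u (Pi.single i 1) < 0
    · by_cases huw : u w ≤ 0
      · exact ⟨u, hu, hle, huw, hpos⟩
      · refine ⟨-u, neg_ne_zero.2 hu, hnegker, by simp; linarith, ?_⟩
        by_contra! hall
        push Not at huw
        have : 0 ≤ (-u) w := isSkewValuation_iff.2 hall w hw
        simp at this
        linarith
    · push Not at hpos
      have h0 : 0 ≤ u w := isSkewValuation_iff.2 hpos w hw
      refine ⟨-u, neg_ne_zero.2 hu, hnegker, by simpa using h0, ?_⟩
      by_contra! hall
      refine hu (LinearMap.ext fun x => ?_)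
      rw [apply_eq_sum_single, LinearMap.zero_apply]
      refine Finset.sum_eq_zero fun i _ => ?_
      have h1 := hall i
      have h2 := hpos i
      rw [LinearMap.neg_apply] at h1
      rw [le_antisymm (by linarith) h2, mul_zero]
  obtain ⟨i₀, hi₀⟩ := hneg
  let α : Fin n ⊕ Finset (Fin n) → ℝ :=
    Sum.elim (fun i => v (Pi.single i 1)) (fun a => v (indicatorVector a) - 1)
  let β : Fin n ⊕ Finset (Fin n) → ℝ :=
    Sum.elim (fun i => u (Pi.single i 1)) (fun a => u (indicatorVector a))
  obtain ⟨t, ht, hall, j, hj, hjneg, hj0⟩ := exists_first_tight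
    (Finset.univ.disjSum A.toFinset) α β (by
      rintro (i | a) hj
      · exact isSkewValuation_iff.1 hv.1 i
      · have ha : a ∈ A := by simpa using hj
        have := hv.2 a ha
        simp only [α, Sum.elim_inr]
        linarith) ⟨Sum.inl i₀, by simp, hi₀⟩
  refine ⟨v + t • u, ⟨isSkewValuation_iff.2 fun i => ?_, fun a ha => ?_⟩, ?_, ?_⟩
  · exact hall (Sum.inl i) (by simp)
  · have := hall (Sum.inr a) (by simpa using ha)
    simp only [α, β, Sum.elim_inr] at this
    simp only [LinearMap.add_apply, LinearMap.smul_apply, smul_eq_mul]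
    linarith
  · have := mul_nonpos_of_nonneg_of_nonpos ht huw
    simp only [LinearMap.add_apply, LinearMap.smul_apply, smul_eq_mul]
    linarith
  · rcases j with i | a
    · exact Or.inl ⟨i, hj0⟩
    · right
      have ha : a ∈ A := by simpa using hj
      have hmem : indicatorVector a ∈ tightSpan A (v + t • u) := by
        refine Submodule.subset_span ⟨a, ⟨ha, ?_⟩, rfl⟩
        simp only [α, β, Sum.elim_inr] at hj0
        simp only [LinearMap.add_apply, LinearMap.smul_apply, smul_eq_mul]
        linarith
      refine lt_of_le_of_ne (Submodule.span_mono (Set.image_mono ?_)) ?_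
      · rintro b ⟨hb, hb1⟩
        refine ⟨hb, ?_⟩
        have : u (indicatorVector b) = 0 := hle (Submodule.subset_span ⟨b, ⟨hb, hb1⟩, rfl⟩)
        simp [hb1, this]
      · intro heq
        rw [← heq] at hmem
        have : u (indicatorVector a) = 0 := hle hmem
        simp only [β, Sum.elim_inr] at hjneg
        linarith

/-- Every element of the blocker is dominated at `w` by one that vanishes on a variable or is
determined by its tight generators. -/
theorem exists_blocker_vertex {A : Set (Finset (Fin n))} {w : Fin n → ℝ} (hw : ∀ i, 0 ≤ w i)
    {v : (Fin n → ℝ) →ₗ[ℝ] ℝ} (hv : v ∈ blocker A) :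
    ∃ v' ∈ blocker A, v' w ≤ v w ∧
      ((∃ i, v' (Pi.single i 1) = 0) ∨ tightSpan A v' = ⊤) := by
  generalize hT : tightSpan A v = T
  induction T using WellFoundedGT.induction generalizing v with
  | ind T ih =>
    subst hT
    by_cases htop : tightSpan A v = ⊤
    · exact ⟨v, hv, le_rfl, Or.inr htop⟩
    · obtain ⟨v', hv', hle, h | h⟩ := exists_blocker_tighter hw hv htop
      · exact ⟨v', hv', hle, Or.inl h⟩
      · obtain ⟨v'', hv'', hle', h'⟩ := ih _ h hv' rfl
        exact ⟨v'', hv'', hle'.trans hle, h'⟩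

/-! ### Asymptotic containment of symbolic in ordinary powers -/

/-- The variables with `n * w i < 1` have total weight below one, so they are not a cover: some
generator has all its coordinates `w i` at least `1 / n`. This gives the bound `n` on the
resurgence. -/
theorem one_le_card_mul_of_mem_blocker {A : Set (Finset (Fin n))} {v : (Fin n → ℝ) →ₗ[ℝ] ℝ}
    (hv : v ∈ blocker A) {w : Fin n → ℝ} (hw : w ∈ symbolicPolyhedron A) : 1 ≤ n * v w := by
  classical
  obtain ⟨a, ha, hle⟩ : ∃ a ∈ A, ∀ i ∈ a, 1 ≤ n * w i := by
    by_contra! hcon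
    have hc : Finset.univ.filter (fun i => n * w i < 1) ∈ vertexCovers A := fun a ha => by
      obtain ⟨i, hi, hlt⟩ := hcon a ha
      exact ⟨i, hi, by simpa using hlt⟩
    have h1 := hw.2 _ hc
    set c := Finset.univ.filter (fun i => n * w i < 1)
    have hne : c.Nonempty := by
      by_contra hne
      rw [Finset.not_nonempty_iff_eq_empty] at hne
      rw [hne, Finset.sum_empty] at h1
      linarith
    have h2 : ∑ i ∈ c, n * w i < ∑ i ∈ c, (1 : ℝ) :=
      Finset.sum_lt_sum_of_nonempty hne fun i hi => by simpa [c] using hi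
    rw [← Finset.mul_sum, Finset.sum_const, nsmul_eq_mul, mul_one] at h2
    have h3 : (c.card : ℝ) ≤ n := by
      exact_mod_cast (Finset.card_le_univ c).trans_eq (Fintype.card_fin n)
    nlinarith [Nat.cast_nonneg (α := ℝ) n]
  calc 1 ≤ v (indicatorVector a) := hv.2 a ha
    _ ≤ v ((n : ℝ) • w) := hv.1.mono fun i => by
      unfold indicatorVector
      split_ifs with hi
      · exact hle i hi
      · exact mul_nonneg (Nat.cast_nonneg _) (hw.1 i)
    _ = n * v w := by rw [map_smul, smul_eq_mul]

theorem pos_of_mem_blocker {A : Set (Finset (Fin n))} {v : (Fin n → ℝ) →ₗ[ℝ] ℝ}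
    (hv : v ∈ blocker A) {w : Fin n → ℝ} (hw : w ∈ symbolicPolyhedron A) : 0 < v w := by
  have := one_le_card_mul_of_mem_blocker hv hw
  by_contra! h
  nlinarith [Nat.cast_nonneg (α := ℝ) n]

theorem mem_of_forall_monomial_mem {J : Ideal (MvPolynomial (Fin n) K)}
    {f : MvPolynomial (Fin n) K} (h : ∀ m ∈ f.support, MvPolynomial.monomial m (1 : K) ∈ J) :
    f ∈ J := by
  rw [f.as_sum]
  refine Ideal.sum_mem _ fun m hm => ?_
  rw [← mul_one (MvPolynomial.coeff m f), ← MvPolynomial.C_mul_monomial]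
  exact Ideal.mul_mem_left _ _ (h m hm)

/-- Round down a fractional packing of generators below `m`. Each coefficient loses less than one,
which the number of subsets of the variables added to `r` absorbs. -/
theorem monomial_mem_pow {A : Set (Finset (Fin n))} {m : Fin n →₀ ℕ} {r : ℕ}
    (h : ∀ v ∈ blocker A, (r : ℝ) + Fintype.card (Finset (Fin n)) ≤ v (realExponent m)) :
    MvPolynomial.monomial m (1 : K) ∈ squarefreeIdeal K A ^ r := by
  classical
  obtain ⟨l, hl0, hlA, hsum, hle⟩ := exists_fractional_packing (realExponent_nonneg m)
    (by have : 0 < Fintype.card (Finset (Fin n)) := Fintype.card_pos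
        positivity) h
  have hexp : ∑ a, ⌊l a⌋₊ • squarefreeExponent a ≤ m := by
    intro i
    rw [← Nat.cast_le (α := ℝ), Finsupp.finsetSum_apply]
    push_cast
    refine le_trans (Finset.sum_le_sum fun a _ => ?_) (hle i)
    have : ((squarefreeExponent a i : ℕ) : ℝ) = indicatorVector a i :=
      congrFun (realExponent_squarefreeExponent a) i
    rw [Pi.smul_apply, smul_eq_mul, Nat.cast_mul, this]
    refine mul_le_mul_of_nonneg_right (Nat.floor_le (hl0 a)) ?_
    unfold indicatorVector
    split_ifs <;> norm_num
  have hr : r ≤ ∑ a, ⌊l a⌋₊ := by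
    rw [← Nat.cast_le (α := ℝ)]
    push_cast
    have h1 : ∑ a, (l a - 1) ≤ ∑ a : Finset (Fin n), (⌊l a⌋₊ : ℝ) :=
      Finset.sum_le_sum fun a _ => (Nat.sub_one_lt_floor (l a)).le
    rw [Finset.sum_sub_distrib, hsum, Finset.sum_const, Finset.card_univ, nsmul_eq_mul,
      mul_one] at h1
    linarith
  rw [← tsub_add_cancel_of_le hexp, ← mul_one (1 : K), ← MvPolynomial.monomial_mul]
  refine Ideal.mul_mem_left _ _ (Ideal.pow_le_pow_right hr ?_)
  rw [MvPolynomial.monomial_sum_one, ← Finset.prod_pow_eq_pow_sum]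
  refine Ideal.prod_mem_prod fun a _ => ?_
  by_cases ha : a ∈ A
  · have hmem : MvPolynomial.monomial (squarefreeExponent a) (1 : K) ∈ squarefreeIdeal K A :=
      prod_X_eq_monomial (K := K) a ▸ Ideal.subset_span ⟨a, ha, rfl⟩
    rw [← one_pow (M := K) ⌊l a⌋₊, ← MvPolynomial.monomial_pow]
    exact Ideal.pow_mem_pow hmem _
  · simp [hlA a ha]

theorem smul_realExponent_mem_symbolicPolyhedron {A : Set (Finset (Fin n))} {s : ℕ} (hs : 0 < s)
    {f : MvPolynomial (Fin n) K} (hf : f ∈ symbolicPower (squarefreeIdeal K A) s)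
    {m : Fin n →₀ ℕ} (hm : m ∈ f.support) :
    (s : ℝ)⁻¹ • realExponent m ∈ symbolicPolyhedron A := by
  have hs' : (0 : ℝ) < s := Nat.cast_pos.2 hs
  refine ⟨fun i => mul_nonneg (inv_nonneg.2 hs'.le) (realExponent_nonneg m i), fun c hc => ?_⟩
  have := le_of_mem_symbolicPower hf hc hm
  simp only [Pi.smul_apply, smul_eq_mul, realExponent]
  rw [← Finset.mul_sum, le_inv_mul_iff₀ hs', mul_one]
  exact_mod_cast this

/-- The exponent vector obtained from `s • w` by rounding up. -/
def ceilExponent (s : ℕ) (w : Fin n → ℝ) : Fin n →₀ ℕ :=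
  Finsupp.equivFunOnFinite.symm fun i => ⌈s * w i⌉₊

theorem monomial_ceilExponent_mem {A : Set (Finset (Fin n))} {w : Fin n → ℝ}
    (hw : w ∈ symbolicPolyhedron A) (s : ℕ) :
    MvPolynomial.monomial (ceilExponent s w) (1 : K) ∈ symbolicPower (squarefreeIdeal K A) s := by
  classical
  refine mem_symbolicPower_of_forall fun c hc m hm => ?_
  rw [MvPolynomial.support_monomial, if_neg one_ne_zero, Finset.mem_singleton] at hm
  subst hm
  rw [← Nat.cast_le (α := ℝ)]
  push_cast
  calc (s : ℝ) ≤ s * ∑ i ∈ c, w i := le_mul_of_one_le_right (Nat.cast_nonneg _) (hw.2 c hc)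
    _ = ∑ i ∈ c, s * w i := Finset.mul_sum _ _ _
    _ ≤ _ := Finset.sum_le_sum fun i _ => Nat.le_ceil _

theorem apply_ceilExponent_le {v : (Fin n → ℝ) →ₗ[ℝ] ℝ} (hv : IsSkewValuation v) {w : Fin n → ℝ}
    (hw : ∀ i, 0 ≤ w i) (s : ℕ) : v (realExponent (ceilExponent s w)) ≤ s * v w + v 1 := by
  have : v (realExponent (ceilExponent s w)) ≤ v ((s : ℝ) • w + 1) := hv.mono fun i =>
    (Nat.ceil_lt_add_one (mul_nonneg (Nat.cast_nonneg _) (hw i))).le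
  rwa [map_add, map_smul, smul_eq_mul] at this

/-- The gain `t * (s * θ - r)` is linear in `t` and eventually exceeds the constant rounding loss.
-/
theorem eventually_symbolicPower_le {A : Set (Finset (Fin n))} {s r : ℕ} (hs : 0 < s) {θ : ℝ}
    (hθ : ∀ v ∈ blocker A, ∀ w ∈ symbolicPolyhedron A, θ ≤ v w) (h : r < s * θ) :
    ∀ᶠ t : ℕ in atTop, symbolicPower (squarefreeIdeal K A) (s * t) ≤
      squarefreeIdeal K A ^ (r * t) := by
  obtain ⟨T, hT⟩ := exists_nat_gt ((Fintype.card (Finset (Fin n)) : ℝ) / (s * θ - r))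
  rw [div_lt_iff₀ (by linarith)] at hT
  filter_upwards [eventually_ge_atTop T, eventually_gt_atTop 0] with t ht ht0 f hf
  refine mem_of_forall_monomial_mem fun m hm => monomial_mem_pow fun v hv => ?_
  have hst : 0 < s * t := Nat.mul_pos hs ht0
  have h1 := hθ v hv _ (smul_realExponent_mem_symbolicPolyhedron hst hf hm)
  rw [map_smul, smul_eq_mul, le_inv_mul_iff₀ (Nat.cast_pos.2 hst)] at h1
  push_cast at h1 ⊢
  have h2 : (T : ℝ) * (s * θ - r) ≤ t * (s * θ - r) :=
    mul_le_mul_of_nonneg_right (Nat.cast_le.2 ht) (by linarith)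
  linarith

/-- Rounding up `s * t • w` gives a monomial of the symbolic power whose `v`-value exceeds `s * t *
v w` by at most the constant `v 1`, hence is eventually below `r * t`. -/
theorem eventually_not_symbolicPower_le {A : Set (Finset (Fin n))} {s r : ℕ}
    {v : (Fin n → ℝ) →ₗ[ℝ] ℝ} (hv : v ∈ blocker A) {w : Fin n → ℝ}
    (hw : w ∈ symbolicPolyhedron A) (h : s * v w < r) :
    ∀ᶠ t : ℕ in atTop, ¬ symbolicPower (squarefreeIdeal K A) (s * t) ≤
      squarefreeIdeal K A ^ (r * t) := by
  classical
  obtain ⟨T, hT⟩ := exists_nat_gt (v 1 / (r - s * v w))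
  rw [div_lt_iff₀ (by linarith)] at hT
  filter_upwards [eventually_ge_atTop T] with t ht hle
  have h1 := le_of_mem_pow hv _ (hle (monomial_ceilExponent_mem (K := K) hw (s * t)))
    (ceilExponent (s * t) w) (by simp [MvPolynomial.support_monomial])
  have h2 := apply_ceilExponent_le hv.1 hw.1 (s * t)
  have h3 : (T : ℝ) * (r - s * v w) ≤ t * (r - s * v w) :=
    mul_le_mul_of_nonneg_right (Nat.cast_le.2 ht) (by linarith)
  push_cast at h1 h2
  linarith

/-! ### The resurgence as a supremum of `1 / v w` -/

theorem exists_nat_div_btwn {a b : ℝ≥0∞} (h : a < b) :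
    ∃ s r : ℕ, 0 < s ∧ 0 < r ∧ a < (s : ℝ≥0∞) / r ∧ (s : ℝ≥0∞) / r < b := by
  obtain ⟨q, hq0, hq1, hq2⟩ := ENNReal.lt_iff_exists_rat_btwn.1 h
  have hden : (0 : ℝ) < q.den := Nat.cast_pos.2 q.den_pos
  have hnum : ((q.num.toNat : ℕ) : ℝ) = q.num := by
    exact_mod_cast Int.toNat_of_nonneg (Rat.num_nonneg.2 hq0)
  have key : ((Real.toNNReal q : NNReal) : ℝ≥0∞) = (q.num.toNat : ℝ≥0∞) / q.den := by
    change ENNReal.ofReal q = _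
    rw [Rat.cast_def, ← hnum, ENNReal.ofReal_div_of_pos hden, ENNReal.ofReal_natCast,
      ENNReal.ofReal_natCast]
  rw [key] at hq1 hq2
  refine ⟨q.num.toNat, q.den, ?_, q.den_pos, hq1, hq2⟩
  by_contra h0
  rw [Nat.eq_zero_of_not_pos h0] at hq1
  simp at hq1

theorem natCast_div_eq_ofReal {s r : ℕ} (hr : 0 < r) :
    (s : ℝ≥0∞) / r = ENNReal.ofReal (s / r) := by
  rw [ENNReal.ofReal_div_of_pos (Nat.cast_pos.2 hr), ENNReal.ofReal_natCast,
    ENNReal.ofReal_natCast]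

theorem inv_le_asymptoticResurgence {A : Set (Finset (Fin n))} {v : (Fin n → ℝ) →ₗ[ℝ] ℝ}
    (hv : v ∈ blocker A) {w : Fin n → ℝ} (hw : w ∈ symbolicPolyhedron A) :
    (ENNReal.ofReal (v w))⁻¹ ≤ asymptoticResurgence (squarefreeIdeal K A) := by
  refine le_of_forall_lt fun q hq => ?_
  obtain ⟨s, r, hs, hr, h1, h2⟩ := exists_nat_div_btwn hq
  refine h1.trans_le (le_sSup ⟨s, r, hs, hr, eventually_not_symbolicPower_le hv hw ?_, rfl⟩)
  have hpos := pos_of_mem_blocker hv hw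
  rw [natCast_div_eq_ofReal hr, ← ENNReal.ofReal_inv_of_pos hpos,
    ENNReal.ofReal_lt_ofReal_iff (inv_pos.2 hpos), div_lt_iff₀ (Nat.cast_pos.2 hr),
    lt_inv_mul_iff₀ hpos] at h2
  linarith

theorem exists_of_lt_asymptoticResurgence {A : Set (Finset (Fin n))} {q : ℝ≥0∞}
    (hq : q < asymptoticResurgence (squarefreeIdeal K A)) :
    ∃ v ∈ blocker A, ∃ w ∈ symbolicPolyhedron A, q < (ENNReal.ofReal (v w))⁻¹ := by
  obtain ⟨_, ⟨s, r, hs, hr, hnot, rfl⟩, hlt⟩ := lt_sSup_iff.1 hq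
  by_contra! hcon
  obtain ⟨a, b, ha, hb, h1, h2⟩ := exists_nat_div_btwn hlt
  have hb' : (0 : ℝ) < b := Nat.cast_pos.2 hb
  have ha' : (0 : ℝ) < a := Nat.cast_pos.2 ha
  have hr' : (0 : ℝ) < r := Nat.cast_pos.2 hr
  have hs' : (0 : ℝ) < s := Nat.cast_pos.2 hs
  -- If all `1 / v w` were at most `q`, then `b / a` would bound `v w` below; `a / b < s / r`
  -- provides the strict slack that forces containment.
  have hle := eventually_symbolicPower_le (K := K) (A := A) (s := s) (r := r) hs
    (θ := (a / b : ℝ)⁻¹) (fun v hv w hw => ?_) ?_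
  · obtain ⟨t, ht1, ht2⟩ := (hnot.and hle).exists
    exact ht1 ht2
  · have hpos := pos_of_mem_blocker hv hw
    have := (hcon v hv w hw).trans h1.le
    rw [natCast_div_eq_ofReal hb, ← ENNReal.ofReal_inv_of_pos hpos,
      ENNReal.ofReal_le_ofReal_iff (by positivity)] at this
    exact inv_le_of_inv_le₀ hpos this
  · rw [natCast_div_eq_ofReal hb, natCast_div_eq_ofReal hr,
      ENNReal.ofReal_lt_ofReal_iff (by positivity), div_lt_div_iff₀ hb' hr'] at h2
    rw [inv_div, mul_div_assoc', lt_div_iff₀ ha']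
    linarith

theorem asymptoticResurgence_lt_top (A : Set (Finset (Fin n))) :
    asymptoticResurgence (squarefreeIdeal K A) < ⊤ := by
  refine lt_of_le_of_lt (b := (n : ℝ≥0∞)) ?_ (ENNReal.natCast_lt_top n)
  by_contra! h
  obtain ⟨v, hv, w, hw, hlt⟩ := exists_of_lt_asymptoticResurgence h
  have hpos := pos_of_mem_blocker hv hw
  have h1 := one_le_card_mul_of_mem_blocker hv hw
  rw [← ENNReal.ofReal_inv_of_pos hpos, ← ENNReal.ofReal_natCast,
    ENNReal.ofReal_lt_ofReal_iff (inv_pos.2 hpos)] at hlt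
  have h2 := mul_lt_mul_of_pos_right hlt hpos
  rw [inv_mul_cancel₀ hpos.ne'] at h2
  linarith

/-- Replace `v` by its composition with the projection that kills the coordinates in `U`, and `w` by
`w` plus the indicator of `U`. The added ones satisfy all covers meeting `U`, the remaining covers
are covers of the contracted family, and the pairing does not increase. -/
theorem asymptoticResurgence_sdiff_le (A : Set (Finset (Fin n))) (U : Finset (Fin n)) :
    asymptoticResurgence (squarefreeIdeal K ((fun a => a \ U) '' A)) ≤
      asymptoticResurgence (squarefreeIdeal K A) := by
  refine le_of_forall_lt fun q hq => ?_
  obtain ⟨v, hv, w, hw, hlt⟩ := exists_of_lt_asymptoticResurgence hq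
  let proj : (Fin n → ℝ) →ₗ[ℝ] (Fin n → ℝ) :=
    LinearMap.pi fun i => if i ∈ U then 0 else LinearMap.proj i
  have hproj : ∀ x i, proj x i = if i ∈ U then 0 else x i := by
    intro x i
    by_cases hi : i ∈ U <;> simp [proj, hi]
  have hv' : v ∘ₗ proj ∈ blocker A := by
    refine ⟨fun x hx => hv.1 _ fun i => ?_, fun a ha => ?_⟩
    · rw [hproj]
      split_ifs
      exacts [le_rfl, hx i]
    · refine (hv.2 _ ⟨a, ha, rfl⟩).trans_eq ?_
      rw [LinearMap.comp_apply]
      congr 1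
      ext i
      rw [hproj]
      by_cases hi : i ∈ U <;> simp [indicatorVector, hi]
  have hw' : w + indicatorVector U ∈ symbolicPolyhedron A := by
    have hU : ∀ i, 0 ≤ indicatorVector U i := fun i => by
      unfold indicatorVector
      split_ifs <;> norm_num
    refine ⟨fun i => add_nonneg (hw.1 i) (hU i), fun c hc => ?_⟩
    simp only [Pi.add_apply, Finset.sum_add_distrib]
    by_cases hcU : ∃ i ∈ c, i ∈ U
    · obtain ⟨i, hi, hiU⟩ := hcU
      have h1 := Finset.single_le_sum (f := indicatorVector U) (fun j _ => hU j) hi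
      have h2 : indicatorVector U i = 1 := by simp [indicatorVector, hiU]
      have h3 := Finset.sum_nonneg fun j (_ : j ∈ c) => hw.1 j
      linarith
    · have h1 := hw.2 c (by
        rintro _ ⟨a, ha, rfl⟩
        obtain ⟨i, hi, hic⟩ := hc a ha
        exact ⟨i, Finset.mem_sdiff.2 ⟨hi, fun hiU => hcU ⟨i, hic, hiU⟩⟩, hic⟩)
      have h2 := Finset.sum_nonneg fun j (_ : j ∈ c) => hU j
      linarith
  refine hlt.trans_le (le_trans ?_ (inv_le_asymptoticResurgence hv' hw'))
  refine ENNReal.inv_le_inv.2 (ENNReal.ofReal_le_ofReal (hv.1.mono fun i => ?_))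
  rw [hproj]
  split_ifs with hi
  · exact hw.1 i
  · simp [indicatorVector, hi]

/-! ### Skew Waldschmidt constants and skew resurgence -/

theorem indicatorVector_mem_exponentVectors {A : Set (Finset (Fin n))} {a : Finset (Fin n)}
    (ha : a ∈ A) : indicatorVector a ∈ exponentVectors (squarefreeIdeal K A) := by
  refine ⟨squarefreeExponent a, ?_, (realExponent_squarefreeExponent a).symm⟩
  rw [← prod_X_eq_monomial]
  exact Ideal.subset_span ⟨a, ha, rfl⟩

theorem exists_indicatorVector_le {A : Set (Finset (Fin n))} {x : Fin n → ℝ}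
    (hx : x ∈ exponentVectors (squarefreeIdeal K A)) : ∃ a ∈ A, ∀ i, indicatorVector a i ≤ x i := by
  obtain ⟨m, hm, rfl⟩ := hx
  obtain ⟨a, ha, hle⟩ := monomial_mem_squarefreeIdeal.1 hm
  refine ⟨a, ha, fun i => ?_⟩
  rw [← realExponent_squarefreeExponent]
  exact Nat.cast_le.2 (squarefreeExponent_le.2 hle i)

theorem le_value {v : (Fin n → ℝ) →ₗ[ℝ] ℝ} {J : Ideal (MvPolynomial (Fin n) K)}
    (hne : (exponentVectors J).Nonempty) {c : ℝ} (h : ∀ x ∈ exponentVectors J, c ≤ v x) :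
    c ≤ value v J := by
  refine le_csInf (hne.image v) ?_
  rintro _ ⟨x, hx, rfl⟩
  exact h x hx

theorem value_le {v : (Fin n → ℝ) →ₗ[ℝ] ℝ} (hv : IsSkewValuation v)
    {J : Ideal (MvPolynomial (Fin n) K)} {x : Fin n → ℝ} (hx : x ∈ exponentVectors J) :
    value v J ≤ v x := by
  refine csInf_le ⟨0, ?_⟩ ⟨x, hx, rfl⟩
  rintro _ ⟨_, ⟨m, _, rfl⟩, rfl⟩
  exact hv _ (realExponent_nonneg m)

/-- Together with `skewWaldschmidt_le`, this identifies the Waldschmidt constant with the infimum of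
`v` on the symbolic polyhedron. -/
theorem le_skewWaldschmidt {A : Set (Finset (Fin n))} {v : (Fin n → ℝ) →ₗ[ℝ] ℝ}
    (hv : IsSkewValuation v) (hA : A.Nonempty) {c : ℝ}
    (h : ∀ w ∈ symbolicPolyhedron A, c ≤ v w) : c ≤ skewWaldschmidt v (squarefreeIdeal K A) := by
  classical
  obtain ⟨a, ha⟩ := hA
  have hne : (exponentVectors (squarefreeIdeal K A)).Nonempty :=
    ⟨_, indicatorVector_mem_exponentVectors ha⟩
  refine ge_of_tendsto (tendsto_skewWaldschmidt hv hne) ?_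
  filter_upwards [eventually_gt_atTop 0] with s hs
  have hs' : (0 : ℝ) < s := Nat.cast_pos.2 hs
  rw [le_div_iff₀ hs']
  refine le_value (exponentVectors_nonempty hne s) ?_
  rintro _ ⟨m, hm, rfl⟩
  have := h _ (smul_realExponent_mem_symbolicPolyhedron hs hm
    (m := m) (by simp [MvPolynomial.support_monomial]))
  rw [map_smul, smul_eq_mul, le_inv_mul_iff₀ hs'] at this
  rw [mul_comm]
  exact this

theorem skewWaldschmidt_le {A : Set (Finset (Fin n))} {v : (Fin n → ℝ) →ₗ[ℝ] ℝ}
    (hv : IsSkewValuation v) (hA : A.Nonempty) {w : Fin n → ℝ} (hw : w ∈ symbolicPolyhedron A) :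
    skewWaldschmidt v (squarefreeIdeal K A) ≤ v w := by
  obtain ⟨a, ha⟩ := hA
  have hne : (exponentVectors (squarefreeIdeal K A)).Nonempty :=
    ⟨_, indicatorVector_mem_exponentVectors ha⟩
  have hlim : Tendsto (fun s : ℕ => v w + v 1 / (s : ℝ)) atTop (𝓝 (v w)) := by
    simpa using (tendsto_const_nhds (x := v w)).add (tendsto_const_div_atTop_nhds_zero_nat (v 1))
  refine le_of_tendsto_of_tendsto (tendsto_skewWaldschmidt hv hne) hlim ?_
  filter_upwards [eventually_gt_atTop 0] with s hs
  have hs' : (0 : ℝ) < s := Nat.cast_pos.2 hs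
  have h1 : value v (symbolicPower (squarefreeIdeal K A) s) ≤ v (realExponent (ceilExponent s w)) :=
    value_le hv ⟨_, monomial_ceilExponent_mem hw s, rfl⟩
  have h2 := apply_ceilExponent_le hv hw.1 s
  rw [div_le_iff₀ hs', add_mul, div_mul_cancel₀ _ hs'.ne']
  linarith

theorem value_smul (t : ℝ) (ht : 0 ≤ t) (v : (Fin n → ℝ) →ₗ[ℝ] ℝ)
    (J : Ideal (MvPolynomial (Fin n) K)) : value (t • v) J = t * value v J := by
  unfold value
  rw [← smul_eq_mul, ← Real.sInf_smul_of_nonneg ht, ← Set.image_smul, Set.image_image]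
  rfl

theorem skewResurgence_smul {v : (Fin n → ℝ) →ₗ[ℝ] ℝ} (hv : IsSkewValuation v) {t : ℝ}
    (ht : 0 < t) {J : Ideal (MvPolynomial (Fin n) K)} (hne : (exponentVectors J).Nonempty) :
    skewResurgence (t • v) J = skewResurgence v J := by
  have htv : IsSkewValuation (t • v) := fun w hw => mul_nonneg ht.le (hv w hw)
  have hW : skewWaldschmidt (t • v) J = t * skewWaldschmidt v J := by
    refine tendsto_nhds_unique (tendsto_skewWaldschmidt htv hne) ?_
    refine ((tendsto_skewWaldschmidt hv hne).const_mul t).congr fun s => ?_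
    rw [value_smul t ht.le, mul_div_assoc]
  unfold skewResurgence
  rw [hW, value_smul t ht.le, ENNReal.ofReal_mul ht.le, ENNReal.ofReal_mul ht.le]
  exact ENNReal.mul_div_mul_left _ _ (ENNReal.ofReal_pos.2 ht).ne' ENNReal.ofReal_ne_top

theorem inv_le_skewResurgence {A : Set (Finset (Fin n))} {v : (Fin n → ℝ) →ₗ[ℝ] ℝ}
    (hv : v ∈ blocker A) (hA : A.Nonempty) {w : Fin n → ℝ} (hw : w ∈ symbolicPolyhedron A) :
    (ENNReal.ofReal (v w))⁻¹ ≤ skewResurgence v (squarefreeIdeal K A) := by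
  obtain ⟨a, ha⟩ := hA
  have h1 : 1 ≤ value v (squarefreeIdeal K A) := by
    refine le_value ⟨_, indicatorVector_mem_exponentVectors ha⟩ fun x hx => ?_
    obtain ⟨b, hb, hle⟩ := exists_indicatorVector_le hx
    exact (hv.2 b hb).trans (hv.1.mono hle)
  rw [← one_div]
  exact ENNReal.div_le_div (ENNReal.one_le_ofReal.2 h1)
    (ENNReal.ofReal_le_ofReal (skewWaldschmidt_le hv.1 ⟨a, ha⟩ hw))

/-- Every `v w` is at least `1 / ρ`, hence so is the Waldschmidt constant, while the tight generator
gives `v(I) ≤ 1`. -/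
theorem skewResurgence_le_of_mem_blocker {A : Set (Finset (Fin n))} {v : (Fin n → ℝ) →ₗ[ℝ] ℝ}
    (hv : v ∈ blocker A) {a : Finset (Fin n)} (ha : a ∈ A) (h1 : v (indicatorVector a) = 1) :
    skewResurgence v (squarefreeIdeal K A) ≤ asymptoticResurgence (squarefreeIdeal K A) := by
  set ρ := asymptoticResurgence (squarefreeIdeal K A) with hρ
  have hρtop : ρ ≠ ⊤ := (asymptoticResurgence_lt_top A).ne
  -- A point of the symbolic polyhedron is needed to see that `ρ` is positive; a member of `A` makes
  -- every cover nonempty.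
  have hone : (1 : Fin n → ℝ) ∈ symbolicPolyhedron A := by
    refine ⟨fun _ => zero_le_one, fun c hc => ?_⟩
    obtain ⟨i, _, hi⟩ := hc a ha
    simpa using Finset.card_pos.2 ⟨i, hi⟩
  have hρpos : 0 < ρ :=
    (ENNReal.inv_pos.2 ENNReal.ofReal_ne_top).trans_le (inv_le_asymptoticResurgence hv hone)
  have hle : (ρ.toReal)⁻¹ ≤ skewWaldschmidt v (squarefreeIdeal K A) := by
    refine le_skewWaldschmidt hv.1 ⟨a, ha⟩ fun w hw => ?_
    have h := inv_le_asymptoticResurgence (K := K) hv hw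
    have hpos := pos_of_mem_blocker hv hw
    rw [← hρ, ← ENNReal.ofReal_inv_of_pos hpos, ENNReal.ofReal_le_iff_le_toReal hρtop] at h
    exact inv_le_of_inv_le₀ hpos h
  have hval : value v (squarefreeIdeal K A) ≤ 1 :=
    (value_le hv.1 (indicatorVector_mem_exponentVectors ha)).trans_eq h1
  calc skewResurgence v (squarefreeIdeal K A) ≤ 1 / ENNReal.ofReal (ρ.toReal)⁻¹ :=
        ENNReal.div_le_div (ENNReal.ofReal_le_one.2 hval) (ENNReal.ofReal_le_ofReal hle)
    _ = ρ := by
      rw [ENNReal.ofReal_inv_of_pos (ENNReal.toReal_pos hρpos.ne' hρtop), one_div, inv_inv,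
        ENNReal.ofReal_toReal hρtop]

/-! ### Facets of the Newton polyhedron -/

/-- The positive definite skew valuations in the blocker whose unit hyperplane is a facet of the
Newton polyhedron. -/
def normalizedFacetValuations (I : Ideal (MvPolynomial (Fin n) K)) : Set ((Fin n → ℝ) →ₗ[ℝ] ℝ) :=
  {v | IsPositiveDefinite v ∧ IsDefiningHalfSpace (newtonPolyhedron I) v 1}

/-- Positive definiteness makes `v` strictly monotone, so an exponent vector on a face `v = 1` must
itself be a generator. -/
theorem eq_indicatorVector_of_apply_eq {v : (Fin n → ℝ) →ₗ[ℝ] ℝ} (hv : IsPositiveDefinite v)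
    {x y : Fin n → ℝ} (hle : ∀ i, x i ≤ y i) (h : v y ≤ v x) : x = y := by
  have h0 : v (y - x) ≤ 0 := by rw [map_sub]; linarith
  rw [apply_eq_sum_single] at h0
  have hnn : ∀ i ∈ Finset.univ, 0 ≤ (y - x) i * v (Pi.single i 1) := fun i _ =>
    mul_nonneg (sub_nonneg.2 (hle i)) (hv.2 i).le
  have hz := (Finset.sum_eq_zero_iff_of_nonneg hnn).1 (le_antisymm h0 (Finset.sum_nonneg hnn))
  ext i
  have := (mul_eq_zero.1 (hz i (Finset.mem_univ i))).resolve_right (hv.2 i).ne'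
  rw [Pi.sub_apply] at this
  linarith

theorem mem_blocker_of_subset_halfSpace {A : Set (Finset (Fin n))} {v : (Fin n → ℝ) →ₗ[ℝ] ℝ}
    (hv : IsSkewValuation v)
    (h : newtonPolyhedron (squarefreeIdeal K A) ⊆ halfSpace v 1) : v ∈ blocker A :=
  ⟨hv, fun _ ha => h (subset_convexHull ℝ _ (indicatorVector_mem_exponentVectors ha))⟩

theorem subset_halfSpace_of_mem_blocker {A : Set (Finset (Fin n))} {v : (Fin n → ℝ) →ₗ[ℝ] ℝ}
    (hv : v ∈ blocker A) : newtonPolyhedron (squarefreeIdeal K A) ⊆ halfSpace v 1 := by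
  refine convexHull_min (fun x hx => ?_) (convex_halfSpace_ge v.isLinear 1)
  obtain ⟨a, ha, hle⟩ := exists_indicatorVector_le hx
  exact (hv.2 a ha).trans (hv.1.mono hle)

/-- If every generator tight for `v` is tight for `v'`, then `v'` is one on the face of the Newton
polyhedron cut out by `v`. -/
theorem apply_eq_one_of_mem_face {A : Set (Finset (Fin n))} {v v' : (Fin n → ℝ) →ₗ[ℝ] ℝ}
    (hv : v ∈ blocker A) (hpd : IsPositiveDefinite v)
    (h : ∀ a ∈ A, v (indicatorVector a) = 1 → v' (indicatorVector a) = 1)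
    {x : Fin n → ℝ} (hx : x ∈ newtonPolyhedron (squarefreeIdeal K A)) (hx1 : v x = 1) :
    v' x = 1 := by
  -- `T` is convex: if a convex combination of points with `v ≥ 1` has `v = 1`, then so does every
  -- point entering with nonzero weight.
  let T : Set (Fin n → ℝ) := {y | 1 ≤ v y ∧ (v y = 1 → v' y = 1)}
  suffices hT : newtonPolyhedron (squarefreeIdeal K A) ⊆ T from (hT hx).2 hx1
  refine convexHull_min (fun y hy => ?_) ?_
  · obtain ⟨a, ha, hle⟩ := exists_indicatorVector_le hy
    refine ⟨(hv.2 a ha).trans (hv.1.mono hle), fun hy1 => ?_⟩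
    have := eq_indicatorVector_of_apply_eq hpd hle (hy1.trans_le (hv.2 a ha))
    subst this
    exact h a ha hy1
  · intro y hy z hz s t hs ht hst
    have h1 := mul_le_mul_of_nonneg_left hy.1 hs
    have h2 := mul_le_mul_of_nonneg_left hz.1 ht
    refine ⟨?_, fun heq => ?_⟩
    · rw [map_add, map_smul, map_smul, smul_eq_mul, smul_eq_mul]
      linarith
    · rw [map_add, map_smul, map_smul, smul_eq_mul, smul_eq_mul] at heq ⊢
      have e1 : s * v y = s * 1 := by linarith
      have e2 : t * v z = t * 1 := by linarith
      have e3 : s * v' y = s := by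
        rcases eq_or_ne s 0 with h0 | h0
        · simp [h0]
        · rw [hy.2 (mul_left_cancel₀ h0 e1), mul_one]
      have e4 : t * v' z = t := by
        rcases eq_or_ne t 0 with h0 | h0
        · simp [h0]
        · rw [hz.2 (mul_left_cancel₀ h0 e2), mul_one]
      linarith

theorem exists_tight_generator {A : Set (Finset (Fin n))} {v : (Fin n → ℝ) →ₗ[ℝ] ℝ}
    (hv : v ∈ blocker A) (hpd : IsPositiveDefinite v)
    (h : (newtonPolyhedron (squarefreeIdeal K A) ∩ hyperplane v 1).Nonempty) :
    ∃ a ∈ A, v (indicatorVector a) = 1 := by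
  by_contra! hcon
  obtain ⟨x, hx, hx1⟩ := h
  -- Without tight generators the hypothesis on `v'` is vacuous, and the zero functional would equal
  -- one on the face.
  have := apply_eq_one_of_mem_face (v' := 0) hv hpd (fun a ha h1 => absurd h1 (hcon a ha)) hx hx1
  simp at this

/-- A facet valuation is determined by its set of tight generators, and there are finitely many such
sets. If `v` and `v'` share this set, `v - v'` vanishes on the `n - 1` dimensional direction space
of the facet and at a point `p` outside that space, hence everywhere. -/
theorem finite_normalizedFacetValuations (A : Set (Finset (Fin n))) :
    (normalizedFacetValuations (squarefreeIdeal K A)).Finite := by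
  refine Set.Finite.of_injOn (f := fun v => {a | a ∈ A ∧ v (indicatorVector a) = 1})
    (t := Set.univ) (fun _ _ => Set.mem_univ _) ?_ Set.finite_univ
  rintro v ⟨hpd, ⟨hsub, p, hp, hp1⟩, hdim⟩ v' ⟨_, ⟨_, _⟩, _⟩ heq
  have hv := mem_blocker_of_subset_halfSpace hpd.1 hsub
  have htight : ∀ a ∈ A, v (indicatorVector a) = 1 → v' (indicatorVector a) = 1 := by
    intro a ha h1
    exact ((Set.ext_iff.1 heq a).1 ⟨ha, h1⟩).2
  set C := newtonPolyhedron (squarefreeIdeal K A) ∩ hyperplane v 1 with hC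
  have hC' : ∀ x ∈ C, v' x = 1 := fun x hx => apply_eq_one_of_mem_face hv hpd htight hx.1 hx.2
  have hle : vectorSpan ℝ C ≤ LinearMap.ker v ⊓ LinearMap.ker (v - v') := by
    rw [vectorSpan_def, Submodule.span_le]
    rintro _ ⟨x, hx, y, hy, rfl⟩
    have e1 : v x = 1 := hx.2
    have e2 : v y = 1 := hy.2
    have e3 := hC' x hx
    have e4 := hC' y hy
    simp [e1, e2, e3, e4]
  have hlt : vectorSpan ℝ C < LinearMap.ker (v - v') := by
    refine lt_of_le_of_ne (hle.trans inf_le_right) fun he => ?_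
    have h1 : p ∈ LinearMap.ker (v - v') := by
      have e1 : v p = 1 := hp1
      simp [e1, hC' p ⟨hp, hp1⟩]
    rw [← he] at h1
    have : v p = 0 := (hle h1).1
    rw [show v p = 1 from hp1] at this
    exact one_ne_zero this
  have hrank := Submodule.finrank_lt_finrank_of_lt hlt
  have htop : LinearMap.ker (v - v') = ⊤ := by
    refine Submodule.eq_top_of_finrank_eq (le_antisymm (Submodule.finrank_le _) ?_)
    rw [Module.finrank_fin_fun]
    omega
  exact sub_eq_zero.1 (LinearMap.ker_eq_top.1 htop)

theorem halfSpace_smul {t : ℝ} (ht : 0 < t) (v : (Fin n → ℝ) →ₗ[ℝ] ℝ) (c : ℝ) :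
    halfSpace (t • v) (t * c) = halfSpace v c := by
  ext x
  exact mul_le_mul_iff_right₀ ht

theorem hyperplane_smul {t : ℝ} (ht : 0 < t) (v : (Fin n → ℝ) →ₗ[ℝ] ℝ) (c : ℝ) :
    hyperplane (t • v) (t * c) = hyperplane v c := by
  ext x
  exact mul_right_inj' ht.ne'

theorem exists_normalized {I : Ideal (MvPolynomial (Fin n) K)} {v : (Fin n → ℝ) →ₗ[ℝ] ℝ}
    (hv : v ∈ facetValuations I) :
    ∃ t : ℝ, 0 < t ∧ t • v ∈ normalizedFacetValuations I := by
  obtain ⟨hpd, c, hc, hdef⟩ := hv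
  have hc' := inv_pos.2 hc
  refine ⟨c⁻¹, hc', ⟨fun w hw => mul_nonneg hc'.le (hpd.1 w hw), fun i => mul_pos hc' (hpd.2 i)⟩,
    ?_⟩
  rw [← inv_mul_cancel₀ hc.ne']
  unfold IsDefiningHalfSpace IsSupportingHalfSpace at *
  rwa [halfSpace_smul hc', hyperplane_smul hc']

theorem exponentVectors_nonempty_of_mem_facetValuations {I : Ideal (MvPolynomial (Fin n) K)}
    {v : (Fin n → ℝ) →ₗ[ℝ] ℝ} (hv : v ∈ facetValuations I) : (exponentVectors I).Nonempty := by
  obtain ⟨_, _, _, ⟨_, p, hp, _⟩, _⟩ := hv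
  exact convexHull_nonempty_iff.1 ⟨p, hp⟩

theorem finite_skewResurgence (A : Set (Finset (Fin n))) :
    ((fun v => skewResurgence v (squarefreeIdeal K A)) ''
      facetValuations (squarefreeIdeal K A)).Finite := by
  refine ((finite_normalizedFacetValuations (K := K) A).image
    fun v => skewResurgence v (squarefreeIdeal K A)).subset ?_
  rintro _ ⟨v, hv, rfl⟩
  obtain ⟨t, ht, htv⟩ := exists_normalized hv
  exact ⟨_, htv, skewResurgence_smul hv.1.1 ht (exponentVectors_nonempty_of_mem_facetValuations hv)⟩

theorem skewResurgence_le {A : Set (Finset (Fin n))} {v : (Fin n → ℝ) →ₗ[ℝ] ℝ}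
    (hv : v ∈ facetValuations (squarefreeIdeal K A)) :
    skewResurgence v (squarefreeIdeal K A) ≤ asymptoticResurgence (squarefreeIdeal K A) := by
  obtain ⟨t, ht, hpd, ⟨hsub, hne⟩, hdim⟩ := exists_normalized hv
  rw [← skewResurgence_smul hv.1.1 ht (exponentVectors_nonempty_of_mem_facetValuations hv)]
  have hmem := mem_blocker_of_subset_halfSpace hpd.1 hsub
  obtain ⟨a, ha, h1⟩ := exists_tight_generator hmem hpd hne
  exact skewResurgence_le_of_mem_blocker hmem ha h1

/-- The tight generators lie on the face and span the whole space, so adding one of them to the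
direction space of the face gives everything: its dimension is at least `n - 1`. It is less than `n`
because the face lies in `v = 1`. -/
theorem mem_facetValuations_of_tightSpan_eq_top {A : Set (Finset (Fin n))} (hn : 0 < n)
    {v : (Fin n → ℝ) →ₗ[ℝ] ℝ} (hv : v ∈ blocker A) (hpos : ∀ i, 0 < v (Pi.single i 1))
    (htop : tightSpan A v = ⊤) : v ∈ facetValuations (squarefreeIdeal K A) := by
  have : NeZero n := ⟨hn.ne'⟩
  set C := newtonPolyhedron (squarefreeIdeal K A) ∩ hyperplane v 1 with hC
  have htight : ∀ a ∈ A, v (indicatorVector a) = 1 → indicatorVector a ∈ C := fun a ha h1 =>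
    ⟨subset_convexHull ℝ _ (indicatorVector_mem_exponentVectors ha), h1⟩
  have hne : ∃ a ∈ A, v (indicatorVector a) = 1 := by
    by_contra! hcon
    have : {a | a ∈ A ∧ v (indicatorVector a) = 1} = ∅ :=
      Set.eq_empty_of_forall_notMem fun a ha => hcon a ha.1 ha.2
    rw [tightSpan, this, Set.image_empty, Submodule.span_empty] at htop
    have := Submodule.mem_bot ℝ |>.1 (htop ▸ Submodule.mem_top : (1 : Fin n → ℝ) ∈ _)
    exact one_ne_zero this
  obtain ⟨a₀, ha₀, h₀⟩ := hne
  refine ⟨⟨hv.1, hpos⟩, 1, one_pos,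
    ⟨subset_halfSpace_of_mem_blocker hv, _, htight a₀ ha₀ h₀⟩, ?_⟩
  rw [← hC]
  have hlt : vectorSpan ℝ C < ⊤ := by
    refine lt_of_le_of_lt (b := LinearMap.ker v) ?_ ?_
    · rw [vectorSpan_def, Submodule.span_le]
      rintro _ ⟨x, hx, y, hy, rfl⟩
      have e1 : v x = 1 := hx.2
      have e2 : v y = 1 := hy.2
      simp [e1, e2]
    · rw [lt_top_iff_ne_top]
      intro h
      have : v (indicatorVector a₀) = 0 := (h ▸ Submodule.mem_top : _ ∈ LinearMap.ker v)
      linarith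
  have hsup : vectorSpan ℝ C ⊔ Submodule.span ℝ {indicatorVector a₀} = ⊤ := by
    rw [eq_top_iff, ← htop, tightSpan, Submodule.span_le]
    rintro _ ⟨a, ⟨ha, h1⟩, rfl⟩
    rw [SetLike.mem_coe, ← sub_add_cancel (indicatorVector a) (indicatorVector a₀)]
    exact Submodule.add_mem_sup (vsub_mem_vectorSpan ℝ (htight a ha h1) (htight a₀ ha₀ h₀))
      (Submodule.mem_span_singleton_self _)
  have h1 := Submodule.finrank_lt_finrank_of_lt hlt
  have h2 := Submodule.finrank_add_le_finrank_add_finrank (vectorSpan ℝ C)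
    (Submodule.span ℝ {indicatorVector a₀})
  have h3 := finrank_span_le_card (R := ℝ) ({indicatorVector a₀} : Set (Fin n → ℝ))
  simp only [Set.toFinset_singleton, Finset.card_singleton] at h3
  rw [hsup] at h2
  rw [finrank_top, Module.finrank_fin_fun] at h1 h2
  omega

/-! ### The dichotomy and the maximum formula -/

theorem exists_lt_of_lt_asymptoticResurgence {A : Set (Finset (Fin n))} (hn : 0 < n) {q : ℝ≥0∞}
    (hq : q < asymptoticResurgence (squarefreeIdeal K A)) :
    (∃ U : Finset (Fin n), U.Nonempty ∧
        q < asymptoticResurgence (contraction (squarefreeIdeal K A) U)) ∨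
      ∃ v ∈ facetValuations (squarefreeIdeal K A), q < skewResurgence v (squarefreeIdeal K A) := by
  obtain ⟨v, hv, w, hw, hlt⟩ := exists_of_lt_asymptoticResurgence hq
  obtain ⟨v', hv', hle, h⟩ := exists_blocker_vertex hw.1 hv
  replace hlt := hlt.trans_le (ENNReal.inv_le_inv.2 (ENNReal.ofReal_le_ofReal hle))
  by_cases hzero : ∃ i, v' (Pi.single i 1) = 0
  · obtain ⟨i, hi⟩ := hzero
    -- Deleting `i` from the generators does not change their `v'`-values, and covers of the
    -- contracted family cover `A`, so `v'` and `w` serve unchanged for the contraction.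
    refine Or.inl ⟨{i}, Finset.singleton_nonempty i, ?_⟩
    rw [contraction_squarefreeIdeal]
    refine hlt.trans_le (inv_le_asymptoticResurgence ⟨hv'.1, ?_⟩ ⟨hw.1, fun c hc => hw.2 c ?_⟩)
    · rintro _ ⟨a, ha, rfl⟩
      have : v' (indicatorVector a) ≤ v' (indicatorVector (a \ {i}) + Pi.single i 1) := by
        refine hv'.1.mono fun j => ?_
        by_cases hj : j = i
        · subst hj
          simp only [indicatorVector, Pi.add_apply, Pi.single_eq_same]
          split_ifs <;> norm_num
        · simp [indicatorVector, hj]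
      rw [map_add, hi, add_zero] at this
      exact (hv'.2 a ha).trans this
    · intro a ha
      obtain ⟨j, hj, hjc⟩ := hc _ ⟨a, ha, rfl⟩
      exact ⟨j, (Finset.mem_sdiff.1 hj).1, hjc⟩
  · have htop := h.resolve_left hzero
    have hpos : ∀ i, 0 < v' (Pi.single i 1) := fun i =>
      lt_of_le_of_ne (isSkewValuation_iff.1 hv'.1 i) fun h0 => hzero ⟨i, h0.symm⟩
    have hmem := mem_facetValuations_of_tightSpan_eq_top (K := K) hn hv' hpos htop
    obtain ⟨x, hx⟩ := exponentVectors_nonempty_of_mem_facetValuations hmem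
    obtain ⟨a, ha, _⟩ := exists_indicatorVector_le hx
    exact Or.inr ⟨v', hmem, hlt.trans_le (inv_le_skewResurgence hv' ⟨a, ha⟩ hw)⟩

theorem contraction_empty (I : Ideal (MvPolynomial (Fin n) K)) : contraction I ∅ = I := by
  ext f
  simp [contraction, mem_saturation]

theorem isGreatest_of_finite {T : Set ℝ≥0∞} {ρ : ℝ≥0∞} (hfin : T.Finite) (hne : T.Nonempty)
    (hle : ∀ x ∈ T, x ≤ ρ) (h : ∀ q < ρ, ∃ x ∈ T, q < x) : IsGreatest T ρ := by
  obtain ⟨x, hx, hmax⟩ := Set.exists_max_image T id hfin hne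
  rcases (hle x hx).eq_or_lt with rfl | hlt
  · exact ⟨hx, hle⟩
  · obtain ⟨y, hy, hxy⟩ := h x hlt
    exact absurd (hmax y hy) (not_le.2 hxy)

end SquarefreeResurgence

end

theorem theoremt {K : Type*} [Field K] (n : ℕ) (I : Ideal (MvPolynomial (Fin n) K))
    (hI : SquarefreeResurgence.IsSquarefreeMonomialIdeal I) :
    SquarefreeResurgence.asymptoticResurgence I < ⊤ ∧
    ((fun v => SquarefreeResurgence.skewResurgence v I) ''
      SquarefreeResurgence.facetValuations I).Finite ∧
    IsGreatest
      (Set.range (fun U : Finset (Fin n) =>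
          SquarefreeResurgence.asymptoticResurgence (SquarefreeResurgence.contraction I U)) ∪
        (fun v => SquarefreeResurgence.skewResurgence v I) ''
          SquarefreeResurgence.facetValuations I)
      (SquarefreeResurgence.asymptoticResurgence I) ∧
    (0 < n →
      IsGreatest
        ((fun U : Finset (Fin n) =>
            SquarefreeResurgence.asymptoticResurgence (SquarefreeResurgence.contraction I U)) ''
            {U | U.Nonempty} ∪
          (fun v => SquarefreeResurgence.skewResurgence v I) ''
            SquarefreeResurgence.facetValuations I)
        (SquarefreeResurgence.asymptoticResurgence I)) := by
  obtain ⟨A, rfl⟩ := hI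
  change SquarefreeResurgence.asymptoticResurgence
    (SquarefreeResurgence.squarefreeIdeal K A) < ⊤ ∧ _
  have hfin := SquarefreeResurgence.finite_skewResurgence (K := K) A
  have hU : ∀ U : Finset (Fin n), SquarefreeResurgence.asymptoticResurgence
      (SquarefreeResurgence.contraction (SquarefreeResurgence.squarefreeIdeal K A) U) ≤
      SquarefreeResurgence.asymptoticResurgence (SquarefreeResurgence.squarefreeIdeal K A) :=
    fun U => by
      rw [SquarefreeResurgence.contraction_squarefreeIdeal]
      exact SquarefreeResurgence.asymptoticResurgence_sdiff_le A U
  refine ⟨SquarefreeResurgence.asymptoticResurgence_lt_top A, hfin, ⟨Or.inl ⟨∅, ?_⟩, ?_⟩,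
    fun hn => SquarefreeResurgence.isGreatest_of_finite
      ((Set.toFinite _).image _ |>.union hfin) ?_ ?_ ?_⟩
  -- With `U = ∅` allowed the maximum is attained by the ideal itself, so only the upper bounds have
  -- content.
  · simp only [SquarefreeResurgence.contraction_empty]
  · rintro _ (⟨U, rfl⟩ | ⟨v, hv, rfl⟩)
    exacts [hU U, SquarefreeResurgence.skewResurgence_le hv]
  -- For `n = 0` there is no nonempty `U`; a variable is needed for the set of values to be
  -- nonempty.
  · exact ⟨_, Or.inl ⟨{⟨0, hn⟩}, Finset.singleton_nonempty _, rfl⟩⟩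
  · rintro _ (⟨U, _, rfl⟩ | ⟨v, hv, rfl⟩)
    exacts [hU U, SquarefreeResurgence.skewResurgence_le hv]
  · intro q hq
    obtain ⟨U, hUne, hlt⟩ | ⟨v, hv, hlt⟩ :=
      SquarefreeResurgence.exists_lt_of_lt_asymptoticResurgence hn hq
    exacts [⟨_, Or.inl ⟨U, hUne, rfl⟩, hlt⟩, ⟨_, Or.inr ⟨v, hv, rfl⟩, hlt⟩]
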